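/- Let $n\ge 1$, $\sigma>0$, $\theta\in\mathbb R^n$, let $K>1$ be an integer, and let $Y\sim\mathcal N(\theta,\sigma^2I_n)$. Let $g=(g_1,\dots,g_n):\mathbb R^n\to\mathbb R^n$ be measurable, and let $\mathrm{PE}(g)=\mathbb E\|g(Y)-\tilde Y\|_2^2$, where $\tilde Y$ is an independent copy of $Y$. *Estimators.* For $\alpha>0$ and $\mathbb R^n$-valued random vectors $w^{(1)},\dots,w^{(K)}$ put $$T_\alpha(w)=\frac1K\sum_{k=1}^K\Big\{\big\|Y-\tfrac1{\sqrt\alpha}w^{(k)}-g\big(Y+\sqrt\alpha\,w^{(k)}\big)\big\|_2^2-\tfrac1\alpha\|w^{(k)}\|_2^2\Big\}.$$ The antithetic cross-validation estimator is $\mathrm{CV}_\alpha=T_\alpha(\omega)$, where $(\omega^{(1)},\dots,\omega^{(K)})$ is jointly Gaussian and independent of $Y$, $\omega^{(k)}\sim\mathcal N(0,\sigma^2I_n)$ for each $k$, and $\mathrm{Cov}(\omega^{(j)},\omega^{(k)})=-\frac{\sigma^2}{K-1}I_n$ for $j\ne k$. The coupled bootstrap estimator is $\mathrm{CB}_\alpha=T_\alpha(\tilde\omega)$,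 where $\tilde\omega^{(1)},\dots,\tilde\omega^{(K)}$ are i.i.d. $\mathcal N(0,\sigma^2I_n)$ and independent of $Y$. For an estimator $T$ put $\mathrm{MSE}(T)=\mathbb E(T-\mathrm{PE}(g))^2\in[0,\infty]$. *Assumptions.* Every component $g_i$ is weakly differentiable: there is a measurable $\nabla g_i:\mathbb R^n\to\mathbb R^n$ such that $g_i(y+z)-g_i(y)=\int_0^1 z\cdot\nabla g_i(y+tz)\,dt$ for almost all $y,z\in\mathbb R^n$. Let $\nabla g$ be the matrix with rows $\nabla g_i$, and assume $\mathbb E\|g(Y)\|_2^4<\infty$ and $\mathbb E\|\nabla g(Y)\|_F^2<\infty$. Assume also that $\mathrm{MSE}(\mathrm{CB}_{\alpha_0})<\infty$ for some $\alpha_0>0$, and that $g$ is not almost everywhere the identity, i.e. $\mathbb P(g(Y)\ne Y)>0$. *Conclusion.* As $\alpha\downarrow0$, $\mathrm{MSE}(\mathrm{CV}_\alpha)$ stays bounded; $\mathrm{MSE}(\mathrm{CB}_\alpha)$ is finite for all small $\alpha$ and of exact order $1/\alpha$, i.e. $c/\alpha\le\mathrm{MSE}(\mathrm{CB}_\alpha)\le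 C/\alpha$ for all small $\alpha$ with constants $0<c\le C<\infty$; and consequently $$\lim_{\alpha\downarrow0}\{\mathrm{MSE}(\mathrm{CV}_\alpha)-\mathrm{MSE}(\mathrm{CB}_\alpha)\}=-\infty.$$ -/

import Mathlib

open MeasureTheory ProbabilityTheory Filter Topology Asymptotics
open scoped ENNReal NNReal

noncomputable section

/-- The isotropic normal distribution `N(θ, σ² I_n)` on `ℝⁿ`. -/
def isoGaussian {n : ℕ} (θ : EuclideanSpace ℝ (Fin n)) (σ : ℝ) :
    Measure (EuclideanSpace ℝ (Fin n)) :=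
  multivariateGaussian θ ((σ ^ 2) • (1 : Matrix (Fin n) (Fin n) ℝ))

/-- `f'` is a weak derivative of `f : ℝⁿ → ℝ`: for almost all `y, z`, the function
`t ↦ z · f' (y + t z)` is integrable on `[0, 1]` and
`f (y + z) - f y = ∫₀¹ z · f' (y + t z) dt`. -/
structure IsWeakGradient {n : ℕ} (f : EuclideanSpace ℝ (Fin n) → ℝ)
    (f' : EuclideanSpace ℝ (Fin n) → EuclideanSpace ℝ (Fin n)) : Prop where
  aestronglyMeasurable : AEStronglyMeasurable f' volume
  eq_integral : ∀ᵐ p : EuclideanSpace ℝ (Fin n) × EuclideanSpace ℝ (Fin n)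
      ∂((volume : Measure (EuclideanSpace ℝ (Fin n))).prod volume),
    IntervalIntegrable (fun t : ℝ => inner ℝ p.2 (f' (p.1 + t • p.2))) volume 0 1 ∧
    f (p.1 + p.2) - f p.1 = ∫ t in (0 : ℝ)..1, inner ℝ p.2 (f' (p.1 + t • p.2))

/-- The Jacobian matrix whose `i`-th row is the weak derivative `Dg i` of the component `g_i`. -/
def jacobian {n : ℕ} (Dg : Fin n → EuclideanSpace ℝ (Fin n) → EuclideanSpace ℝ (Fin n))
    (y : EuclideanSpace ℝ (Fin n)) : Matrix (Fin n) (Fin n) ℝ :=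
  Matrix.of fun i j => Dg i y j

/-- The squared Frobenius norm `‖A‖_F²`. -/
def frobeniusSq {n : ℕ} (A : Matrix (Fin n) (Fin n) ℝ) : ℝ :=
  ∑ i, ∑ j, (A i j) ^ 2

/-- The prediction error `PE(g) = E ‖g(Y) - Y'‖²`, where `Y` and `Y'` are independent with
common law `μ`. -/
def predictionError {n : ℕ} (μ : Measure (EuclideanSpace ℝ (Fin n)))
    (g : EuclideanSpace ℝ (Fin n) → EuclideanSpace ℝ (Fin n)) : ℝ :=
  ∫ p, ‖g p.1 - p.2‖ ^ 2 ∂(μ.prod μ)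

/-- The estimate from one train-test repetition, with data `y` and randomization `w`:
the train vector is `y + √α w`, the test vector is `y - w / √α`, and the value is
`‖test - g(train)‖² - ‖w‖² / α`. -/
def foldEstimate {n : ℕ} (g : EuclideanSpace ℝ (Fin n) → EuclideanSpace ℝ (Fin n)) (α : ℝ)
    (y w : EuclideanSpace ℝ (Fin n)) : ℝ :=
  ‖(y - (1 / √α) • w) - g (y + √α • w)‖ ^ 2 - (1 / α) * ‖w‖ ^ 2

/-- The average of the `K` train-test repetitions with randomization variables `ω 0, …, ω (K-1)`.
It is `CV_α` when the `ω k` are antithetic, and `CB_α` when they are independent. -/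
def randomizedEstimator {Ω : Type*} {n K : ℕ}
    (g : EuclideanSpace ℝ (Fin n) → EuclideanSpace ℝ (Fin n)) (α : ℝ)
    (Y : Ω → EuclideanSpace ℝ (Fin n)) (ω : Fin K → Ω → EuclideanSpace ℝ (Fin n)) (x : Ω) : ℝ :=
  (1 / (K : ℝ)) * ∑ k, foldEstimate g α (Y x) (ω k x)

/-- The mean squared error `E (T - c)²` of `T` as an estimator of the number `c`,
with values in `[0, ∞]`. -/
def mse {Ω : Type*} [MeasurableSpace Ω] (P : Measure Ω) (T : Ω → ℝ) (c : ℝ) : ℝ≥0∞ :=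
  ∫⁻ x, ENNReal.ofReal ((T x - c) ^ 2) ∂P

/-- Antithetic Gaussian randomization, independent of the data `Y`: the `ω k` are jointly Gaussian,
each has law `N(0, σ² I_n)`, and `Cov(ω j, ω k) = -σ² / (K - 1) I_n` for `j ≠ k`. -/
structure IsAntitheticRandomization {Ω : Type*} [MeasurableSpace Ω] {n K : ℕ} (P : Measure Ω)
    (σ : ℝ) (Y : Ω → EuclideanSpace ℝ (Fin n)) (ω : Fin K → Ω → EuclideanSpace ℝ (Fin n)) :
    Prop where
  gaussian : HasGaussianLaw (fun x k => ω k x) P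
  law : ∀ k, HasLaw (ω k) (isoGaussian 0 σ) P
  cov_eq : ∀ j k, j ≠ k → ∀ a b : Fin n,
    covariance (fun x => ω j x a) (fun x => ω k x b) P =
      if a = b then -(σ ^ 2 / ((K : ℝ) - 1)) else 0
  indep : IndepFun Y (fun x k => ω k x) P

/-- Independent Gaussian randomization, independent of the data `Y`: the `ω k` are i.i.d. with
law `N(0, σ² I_n)`. -/
structure IsIndependentRandomization {Ω : Type*} [MeasurableSpace Ω] {n K : ℕ} (P : Measure Ω)
    (σ : ℝ) (Y : Ω → EuclideanSpace ℝ (Fin n)) (ω : Fin K → Ω → EuclideanSpace ℝ (Fin n)) :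
    Prop where
  law : ∀ k, HasLaw (ω k) (isoGaussian 0 σ) P
  iIndep : iIndepFun ω P
  indep : IndepFun Y (fun x k => ω k x) P

end

/-! Expanding the square in one fold cancels `‖w‖² / α` and leaves `‖y - g(y + √α w)‖²`, plus twice
`⟨w, g(y + √α w) - g(y)⟩ / √α`, minus `(2/√α) ⟨w, y - g(y)⟩` (`foldEstimate_eq`). The first two
terms stay bounded in `L²` as `α ↓ 0`. The last is linear in `w`, so after averaging it sees the
noise only through its mean. The antithetic mean vanishes almost surely, so nothing singular
remains. For independent noise its second moment is `(4/α)(σ²/K) E‖Y - g(Y)‖²`, which is finite, and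
positive because `g` is not almost surely the identity.

Boundedness of the first two terms carries the analysis. Given `Y`, the independent folds are
i.i.d., so finite MSE at `α₀` makes each fold square integrable, hence `E‖g(Y + √α₀ ω)‖⁴ < ∞`. Since
`Y + √α ω` has law `N(θ, (1+α)σ²I)`, whose density for `α ≤ α₀` is at most a constant times the one
for `α₀`, this moment is uniformly bounded (`exists_lintegral_norm_pow_four_le`).

The Jacobian is controlled only at `Y`, not at perturbed data. Where `‖√α w‖(1 + ‖y - θ‖) ≤ 1`,
translating along the segment changes the Gaussian density by a bounded factor, and the weak
derivative formula bounds the increment. Elsewhere `1/α ≤ ‖w‖²(1 + ‖y - θ‖)²`, and moments of the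
Gaussians and of `g` suffice (`exists_lintegral_sq_incrementQuotient_le`). -/

/-! ### Isotropic Gaussians: density, comparison of variances, small translations. -/

lemma posSemidef_sq_smul_one {n : ℕ} (s : ℝ) :
    ((s ^ 2) • (1 : Matrix (Fin n) (Fin n) ℝ)).PosSemidef :=
  Matrix.PosSemidef.one.smul (sq_nonneg s)

instance {n : ℕ} (θ : EuclideanSpace ℝ (Fin n)) (s : ℝ) : IsGaussian (isoGaussian θ s) := by
  unfold isoGaussian; infer_instance

lemma charFun_isoGaussian {n : ℕ} (θ : EuclideanSpace ℝ (Fin n)) (s : ℝ)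
    (t : EuclideanSpace ℝ (Fin n)) :
    charFun (isoGaussian θ s) t
      = Complex.exp (inner ℝ t θ * Complex.I - s ^ 2 * ‖t‖ ^ 2 / 2) := by
  rw [isoGaussian, charFun_multivariateGaussian (posSemidef_sq_smul_one s)]
  congr 2
  rw [Matrix.smul_mulVec, Matrix.one_mulVec, dotProduct_smul]
  have : (t : Fin n → ℝ) ⬝ᵥ t = ‖t‖ ^ 2 := by
    rw [EuclideanSpace.real_norm_sq_eq]; simp [dotProduct, sq]
  rw [this]
  push_cast [smul_eq_mul]
  ring

/-- The Lebesgue density of `isoGaussian θ s`. -/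
noncomputable def isoGaussianDensity {n : ℕ} (θ : EuclideanSpace ℝ (Fin n)) (s : ℝ)
    (y : EuclideanSpace ℝ (Fin n)) : ℝ :=
  ((2 * Real.pi * s ^ 2) ^ ((n : ℝ) / 2))⁻¹ * Real.exp (-(1 / (2 * s ^ 2)) * ‖y - θ‖ ^ 2)

lemma isoGaussianDensity_pos {n : ℕ} (θ : EuclideanSpace ℝ (Fin n)) {s : ℝ} (hs : 0 < s)
    (y : EuclideanSpace ℝ (Fin n)) : 0 < isoGaussianDensity θ s y := by
  unfold isoGaussianDensity
  have := Real.pi_pos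
  positivity

@[fun_prop]
lemma measurable_isoGaussianDensity {n : ℕ} (θ : EuclideanSpace ℝ (Fin n)) (s : ℝ) :
    Measurable (isoGaussianDensity θ s) := by
  unfold isoGaussianDensity
  fun_prop

lemma integrable_isoGaussianDensity {n : ℕ} (θ : EuclideanSpace ℝ (Fin n)) {s : ℝ} (hs : 0 < s) :
    Integrable (isoGaussianDensity θ s) := by
  unfold isoGaussianDensity
  refine Integrable.const_mul ?_ _
  have hb : 0 < ((1 / (2 * s ^ 2) : ℝ) : ℂ).re := by
    rw [Complex.ofReal_re]; positivity
  have h := GaussianFourier.integrable_cexp_neg_mul_sq_norm_add hb 0 (0 : EuclideanSpace ℝ (Fin n))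
  have h2 : Integrable (fun v : EuclideanSpace ℝ (Fin n) ↦
      Real.exp (-(1 / (2 * s ^ 2)) * ‖v‖ ^ 2)) := by
    refine h.norm.congr (.of_forall fun v ↦ ?_)
    simp only [Complex.norm_exp]
    congr 1
    simp [← Complex.ofReal_pow, ← Complex.ofReal_mul]
  exact h2.comp_sub_right θ

lemma integral_cexp_isoGaussianDensity {n : ℕ} (θ : EuclideanSpace ℝ (Fin n)) {s : ℝ} (hs : 0 < s)
    (t : EuclideanSpace ℝ (Fin n)) :
    ∫ x, isoGaussianDensity θ s x • Complex.exp (inner ℝ x t * Complex.I)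
      = Complex.exp (inner ℝ t θ * Complex.I - s ^ 2 * ‖t‖ ^ 2 / 2) := by
  -- Centre at `θ`, then use the complex Gaussian integral with parameter `1/(2s²)`.
  rw [← integral_add_right_eq_self _ θ]
  have hb : 0 < ((1 / (2 * s ^ 2) : ℝ) : ℂ).re := by
    rw [Complex.ofReal_re]; positivity
  have key := GaussianFourier.integral_cexp_neg_mul_sq_norm_add hb Complex.I t
  have hpi := Real.pi_pos
  have hc : ((Real.pi : ℂ) / ((1 / (2 * s ^ 2) : ℝ) : ℂ)) ^ ((n : ℂ) / 2)
      = (((2 * Real.pi * s ^ 2) ^ ((n : ℝ) / 2) : ℝ) : ℂ) := by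
    rw [Complex.ofReal_cpow (by positivity)]
    congr 1
    · push_cast; field_simp
    · push_cast; rfl
  rw [finrank_euclideanSpace_fin, hc] at key
  have hpos : (0 : ℝ) < (2 * Real.pi * s ^ 2) ^ ((n : ℝ) / 2) := by positivity
  calc _ = ∫ v : EuclideanSpace ℝ (Fin n),
        ((((2 * Real.pi * s ^ 2) ^ ((n : ℝ) / 2) : ℝ) : ℂ)⁻¹
            * Complex.exp (inner ℝ t θ * Complex.I)) *
          Complex.exp (-((1 / (2 * s ^ 2) : ℝ) : ℂ) * ‖v‖ ^ 2 + Complex.I * inner ℝ t v) := by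
        refine integral_congr_ae (.of_forall fun v ↦ ?_)
        simp only [isoGaussianDensity, add_sub_cancel_right, real_inner_comm t, inner_add_right,
          Complex.real_smul]
        rw [Complex.ofReal_mul, Complex.ofReal_inv, mul_assoc (Inv.inv _), mul_assoc (Inv.inv _),
          Complex.ofReal_exp, ← Complex.exp_add, ← Complex.exp_add]
        congr 2
        push_cast
        ring
    _ = _ := by
        rw [integral_const_mul, key]
        have h0 : (((2 * Real.pi * s ^ 2) ^ ((n : ℝ) / 2) : ℝ) : ℂ) ≠ 0 := by
          exact_mod_cast hpos.ne'
        have hs' : (s : ℂ) ≠ 0 := by exact_mod_cast hs.ne'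
        rw [show ∀ a b c : ℂ, a⁻¹ * b * (a * c) = (a⁻¹ * a) * (b * c) by intros; ring,
          inv_mul_cancel₀ h0, one_mul, ← Complex.exp_add]
        congr 1
        push_cast
        rw [Complex.I_sq]
        field_simp
        ring

/-- Two finite measures with the same characteristic function coincide. -/
lemma isoGaussian_eq_withDensity {n : ℕ} (θ : EuclideanSpace ℝ (Fin n)) {s : ℝ} (hs : 0 < s) :
    isoGaussian θ s = volume.withDensity fun y ↦ ENNReal.ofReal (isoGaussianDensity θ s y) := by
  have hfin := isFiniteMeasure_withDensity_ofReal (integrable_isoGaussianDensity θ hs).2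
  refine Measure.ext_of_charFun ?_
  ext t
  rw [charFun_isoGaussian, charFun_apply,
    integral_withDensity_eq_integral_toReal_smul (by fun_prop) (by simp)]
  simp_rw [ENNReal.toReal_ofReal (isoGaussianDensity_pos θ hs _).le]
  exact (integral_cexp_isoGaussianDensity θ hs t).symm

lemma isoGaussian_absolutelyContinuous {n : ℕ} (θ : EuclideanSpace ℝ (Fin n)) {s : ℝ}
    (hs : 0 < s) : isoGaussian θ s ≪ volume := by
  rw [isoGaussian_eq_withDensity θ hs]
  exact withDensity_absolutelyContinuous _ _

lemma lintegral_isoGaussian {n : ℕ} (θ : EuclideanSpace ℝ (Fin n)) {s : ℝ} (hs : 0 < s)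
    {f : EuclideanSpace ℝ (Fin n) → ℝ≥0∞} (hf : Measurable f) :
    ∫⁻ y, f y ∂isoGaussian θ s = ∫⁻ y, ENNReal.ofReal (isoGaussianDensity θ s y) * f y := by
  rw [isoGaussian_eq_withDensity θ hs, lintegral_withDensity_eq_lintegral_mul _ (by fun_prop) hf]
  rfl

/-- Up to a constant, a Gaussian integral is monotone in the standard deviation. -/
lemma lintegral_isoGaussian_le {n : ℕ} (θ : EuclideanSpace ℝ (Fin n)) {σ s s' : ℝ} (hσ : 0 < σ)
    (hs : σ ≤ s) (hs' : s ≤ s') {f : EuclideanSpace ℝ (Fin n) → ℝ≥0∞} (hf : Measurable f) :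
    ∫⁻ y, f y ∂isoGaussian θ s ≤
      ENNReal.ofReal ((2 * Real.pi * s' ^ 2) ^ ((n : ℝ) / 2) / (2 * Real.pi * σ ^ 2) ^ ((n : ℝ) / 2))
        * ∫⁻ y, f y ∂isoGaussian θ s' := by
  have hs0 : 0 < s := hσ.trans_le hs
  have hs0' : 0 < s' := hs0.trans_le hs'
  have hpi := Real.pi_pos
  rw [lintegral_isoGaussian θ hs0 hf, lintegral_isoGaussian θ hs0' hf,
    ← lintegral_const_mul _ (by fun_prop)]
  refine lintegral_mono fun y ↦ ?_
  rw [← mul_assoc, ← ENNReal.ofReal_mul (by positivity)]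
  gcongr
  -- The exponential factor increases with the standard deviation, so only the normalizing constants
  -- need comparing; the prefactor turns the one of `s'` into the one of `σ`.
  unfold isoGaussianDensity
  have h1 : (0 : ℝ) < (2 * Real.pi * s' ^ 2) ^ ((n : ℝ) / 2) := by positivity
  rw [← mul_assoc, div_mul_eq_mul_div, mul_inv_cancel₀ h1.ne', ← one_div]
  gcongr

/-- The condition bounds both `‖v‖` and `‖v‖ ‖y - θ‖` by 1, so `‖y + v - θ‖²` exceeds `‖y - θ‖²` by
at most `2 + 1 ≤ 4`, and `4/(2s²) = 2/s²`. -/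
lemma isoGaussianDensity_le_add {n : ℕ} (θ : EuclideanSpace ℝ (Fin n)) {s : ℝ} (hs : 0 < s)
    {y v : EuclideanSpace ℝ (Fin n)} (h : ‖v‖ * (1 + ‖y - θ‖) ≤ 1) :
    isoGaussianDensity θ s y
      ≤ Real.exp (2 / s ^ 2) * isoGaussianDensity θ s (y + v) := by
  unfold isoGaussianDensity
  have hpi := Real.pi_pos
  rw [mul_left_comm, ← Real.exp_add]
  gcongr
  have h1 : y + v - θ = (y - θ) + v := by abel
  have hv : ‖v‖ ≤ 1 := by nlinarith [norm_nonneg v, norm_nonneg (y - θ)]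
  have hr : ‖v‖ * ‖y - θ‖ ≤ 1 := by nlinarith [norm_nonneg v, norm_nonneg (y - θ)]
  have h2 : ‖y + v - θ‖ ^ 2 ≤ ‖y - θ‖ ^ 2 + 4 := by
    have : ‖y + v - θ‖ ≤ ‖y - θ‖ + ‖v‖ := by rw [h1]; exact norm_add_le _ _
    have h3 : ‖y + v - θ‖ ^ 2 ≤ (‖y - θ‖ + ‖v‖) ^ 2 := by gcongr
    nlinarith [norm_nonneg v]
  have h4 : 2 / s ^ 2 = 1 / (2 * s ^ 2) * 4 := by field_simp; norm_num
  rw [h4]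
  have h5 : (0 : ℝ) < 1 / (2 * s ^ 2) := by positivity
  nlinarith

/-- Small shifts of the data change Gaussian integrals at most by a constant factor. -/
lemma lintegral_isoGaussian_indicator_add_le {n : ℕ} (θ : EuclideanSpace ℝ (Fin n)) {s : ℝ}
    (hs : 0 < s) (v : EuclideanSpace ℝ (Fin n)) {f : EuclideanSpace ℝ (Fin n) → ℝ≥0∞}
    (hf : Measurable f) :
    ∫⁻ y, {y | ‖v‖ * (1 + ‖y - θ‖) ≤ 1}.indicator (fun y ↦ f (y + v)) y ∂isoGaussian θ s
      ≤ ENNReal.ofReal (Real.exp (2 / s ^ 2)) * ∫⁻ y, f y ∂isoGaussian θ s := by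
  have hm : MeasurableSet {y : EuclideanSpace ℝ (Fin n) | ‖v‖ * (1 + ‖y - θ‖) ≤ 1} :=
    measurableSet_le (by fun_prop) (by fun_prop)
  rw [lintegral_isoGaussian θ hs (Measurable.indicator (by fun_prop) hm),
    lintegral_isoGaussian θ hs hf, ← lintegral_const_mul _ (by fun_prop),
    ← lintegral_add_right_eq_self
      (fun y ↦ ENNReal.ofReal (Real.exp (2 / s ^ 2)) * (ENNReal.ofReal _ * f y)) v]
  refine lintegral_mono fun y ↦ ?_
  by_cases h : y ∈ {y : EuclideanSpace ℝ (Fin n) | ‖v‖ * (1 + ‖y - θ‖) ≤ 1}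
  · rw [Set.indicator_of_mem h, ← mul_assoc, ← ENNReal.ofReal_mul (by positivity)]
    gcongr
    exact isoGaussianDensity_le_add θ hs h
  · simp [Set.indicator_of_notMem h]

/-- This is the law of the train vector; characteristic functions of independent summands multiply.
-/
lemma map_add_smul_isoGaussian {n : ℕ} (θ : EuclideanSpace ℝ (Fin n)) (s : ℝ) {α : ℝ}
    (hα : 0 ≤ α) :
    ((isoGaussian θ s).prod (isoGaussian 0 s)).map (fun p ↦ p.1 + √α • p.2)
      = isoGaussian θ (√(1 + α) * s) := by
  have h1 : (isoGaussian (0 : EuclideanSpace ℝ (Fin n)) s).map (fun w ↦ √α • w)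
      = isoGaussian 0 (√α * s) := by
    refine Measure.ext_of_charFun ?_
    ext t
    rw [charFun_map_smul, charFun_isoGaussian, charFun_isoGaussian]
    simp only [inner_zero_right, norm_smul, Real.norm_eq_abs, abs_of_nonneg (Real.sqrt_nonneg α)]
    push_cast
    ring_nf
  have h2 : ((isoGaussian θ s).prod (isoGaussian (0 : EuclideanSpace ℝ (Fin n)) s)).map
      (fun p ↦ p.1 + √α • p.2)
      = ((isoGaussian θ s).prod (isoGaussian 0 (√α * s))).map (fun p ↦ p.1 + p.2) := by
    rw [← h1, ← Measure.map_id (μ := isoGaussian θ s), Measure.map_prod_map _ _ (by fun_prop)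
      (by fun_prop), Measure.map_map (by fun_prop) (by fun_prop), Measure.map_id]
    rfl
  rw [h2]
  refine Measure.ext_of_charFun ?_
  ext t
  rw [charFun_map_add_prod_eq_mul, Pi.mul_apply, charFun_isoGaussian, charFun_isoGaussian,
    charFun_isoGaussian, ← Complex.exp_add]
  congr 1
  have ha : ((√α : ℝ) : ℂ) ^ 2 = α := by rw [← Complex.ofReal_pow, Real.sq_sqrt hα]
  have hb : ((√(1 + α) : ℝ) : ℂ) ^ 2 = 1 + α := by
    rw [← Complex.ofReal_pow, Real.sq_sqrt (by linarith)]; push_cast; ring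
  push_cast
  rw [mul_pow, mul_pow, ha, hb]
  simp only [inner_zero_right]
  push_cast
  ring

lemma lintegral_norm_pow_isoGaussian_lt_top {n : ℕ} (θ : EuclideanSpace ℝ (Fin n)) (s : ℝ)
    (p : ℕ) : ∫⁻ y, ENNReal.ofReal (‖y‖ ^ p) ∂isoGaussian θ s < ∞ := by
  have h := (IsGaussian.memLp_id (isoGaussian θ s) p (by simp)).integrable_norm_pow'
  have := h.lintegral_lt_top
  simpa using this

/-- The pair (data, scaled noise) has a law absolutely continuous with respect to Lebesgue
measure. -/
lemma quasiMeasurePreserving_prod_smul {n : ℕ} (θ : EuclideanSpace ℝ (Fin n)) {s c : ℝ}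
    (hs : 0 < s) (hc : c ≠ 0) :
    Measure.QuasiMeasurePreserving
      (fun p : EuclideanSpace ℝ (Fin n) × EuclideanSpace ℝ (Fin n) ↦ (p.1, c • p.2))
      ((isoGaussian θ s).prod (isoGaussian 0 s))
      ((volume : Measure (EuclideanSpace ℝ (Fin n))).prod volume) where
  measurable := by fun_prop
  absolutelyContinuous := by
    have h := Measure.map_prod_map (isoGaussian θ s)
      (isoGaussian (0 : EuclideanSpace ℝ (Fin n)) s) (f := id) (g := fun w ↦ c • w)
      (by fun_prop) (by fun_prop)
    have h' : Prod.map id (fun w : EuclideanSpace ℝ (Fin n) ↦ c • w)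
      = fun p : EuclideanSpace ℝ (Fin n) × EuclideanSpace ℝ (Fin n) ↦ (p.1, c • p.2) := rfl
    rw [← h', ← h, Measure.map_id]
    refine Measure.AbsolutelyContinuous.prod (isoGaussian_absolutelyContinuous θ hs) ?_
    exact ((isoGaussian_absolutelyContinuous 0 hs).map (by fun_prop)).trans
      (Measure.quasiMeasurePreserving_smul volume hc).absolutelyContinuous

/-! ### Increments of weakly differentiable maps. -/

lemma sq_lintegral_enorm_le {X : Type*} [MeasurableSpace X] {μ : Measure X}
    [IsProbabilityMeasure μ] {f : X → ℝ} (hf : AEStronglyMeasurable f μ) :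
    (∫⁻ x, ‖f x‖ₑ ∂μ) ^ 2 ≤ ∫⁻ x, ‖f x‖ₑ ^ 2 ∂μ := by
  have h := eLpNorm_le_eLpNorm_of_exponent_le (p := 1) (q := 2) (by norm_num) hf
  rw [eLpNorm_one_eq_lintegral_enorm] at h
  have h2 := eLpNorm_nnreal_pow_eq_lintegral (f := f) (μ := μ) (p := 2) (by norm_num)
  norm_num at h2
  rw [← h2]
  gcongr

/-- For fixed `t` and `z` the translation `y ↦ y + t z` preserves volume, so Fubini applies. This
permits changing the Jacobian on a null set inside segment integrals. -/
lemma ae_ae_add_smul_notMem {n : ℕ} {N : Set (EuclideanSpace ℝ (Fin n))} (hN : volume N = 0) :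
    ∀ᵐ p : EuclideanSpace ℝ (Fin n) × EuclideanSpace ℝ (Fin n)
      ∂((volume : Measure (EuclideanSpace ℝ (Fin n))).prod volume),
      ∀ᵐ t : ℝ, p.1 + t • p.2 ∉ N := by
  -- Exchanging the quantifiers needs a measurable set, so `N` is replaced by its measurable hull.
  suffices h : ∀ᵐ p : EuclideanSpace ℝ (Fin n) × EuclideanSpace ℝ (Fin n)
      ∂((volume : Measure (EuclideanSpace ℝ (Fin n))).prod volume),
      ∀ᵐ t : ℝ, p.1 + t • p.2 ∉ toMeasurable volume N by
    filter_upwards [h] with p hp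
    filter_upwards [hp] with t ht using fun h ↦ ht (subset_toMeasurable _ _ h)
  have hM : MeasurableSet (toMeasurable volume N) := measurableSet_toMeasurable _ _
  rw [Measure.ae_ae_comm (by
    refine MeasurableSet.compl ?_
    exact hM.preimage (by fun_prop :
      Measurable fun x : (EuclideanSpace ℝ (Fin n) × EuclideanSpace ℝ (Fin n)) × ℝ ↦
        x.1.1 + x.2 • x.1.2))]
  refine .of_forall fun t ↦ ?_
  rw [Measure.ae_prod_iff_ae_ae (by
    refine MeasurableSet.compl ?_
    exact hM.preimage (by fun_prop :
      Measurable fun x : EuclideanSpace ℝ (Fin n) × EuclideanSpace ℝ (Fin n) ↦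
        x.1 + t • x.2)),
    Measure.ae_ae_comm (by
    refine MeasurableSet.compl ?_
    exact hM.preimage (by fun_prop :
      Measurable fun x : EuclideanSpace ℝ (Fin n) × EuclideanSpace ℝ (Fin n) ↦
        x.1 + t • x.2))]
  refine .of_forall fun z ↦ ?_
  have h0 : ∀ᵐ y : EuclideanSpace ℝ (Fin n), y ∉ toMeasurable volume N := by
    rw [ae_iff]; simpa using hN
  exact (measurePreserving_add_right volume (t • z)).quasiMeasurePreserving.ae h0

lemma sum_sq_inner_le_frobeniusSq {n : ℕ}
    (Dg : Fin n → EuclideanSpace ℝ (Fin n) → EuclideanSpace ℝ (Fin n))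
    (z y : EuclideanSpace ℝ (Fin n)) :
    ∑ i, (inner ℝ z (Dg i y)) ^ 2 ≤ ‖z‖ ^ 2 * frobeniusSq (jacobian Dg y) := by
  unfold frobeniusSq jacobian
  rw [Finset.mul_sum]
  refine Finset.sum_le_sum fun i _ ↦ ?_
  have h1 : ∑ j, (Matrix.of (fun i j ↦ Dg i y j) i j) ^ 2 = ‖Dg i y‖ ^ 2 := by
    rw [EuclideanSpace.real_norm_sq_eq]; rfl
  rw [h1, ← mul_pow]
  exact sq_le_sq.2 (by
    rw [abs_of_nonneg (by positivity : 0 ≤ ‖z‖ * ‖Dg i y‖)]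
    exact abs_real_inner_le_norm _ _)

/-- Increments of a weakly differentiable map are controlled by averages of the squared Frobenius
norm of its weak Jacobian along segments. -/
lemma ae_ofReal_norm_sub_sq_le {n : ℕ} {g : EuclideanSpace ℝ (Fin n) → EuclideanSpace ℝ (Fin n)}
    {Dg : Fin n → EuclideanSpace ℝ (Fin n) → EuclideanSpace ℝ (Fin n)}
    (hDg : ∀ i, IsWeakGradient (fun y => g y i) (Dg i))
    {F : EuclideanSpace ℝ (Fin n) → ℝ≥0∞}
    (hF : (fun y ↦ ENNReal.ofReal (frobeniusSq (jacobian Dg y))) =ᵐ[volume] F) :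
    ∀ᵐ p : EuclideanSpace ℝ (Fin n) × EuclideanSpace ℝ (Fin n)
      ∂((volume : Measure (EuclideanSpace ℝ (Fin n))).prod volume),
      ENNReal.ofReal (‖g (p.1 + p.2) - g p.1‖ ^ 2) ≤
        ENNReal.ofReal (‖p.2‖ ^ 2) * ∫⁻ t in Set.Ioc (0 : ℝ) 1, F (p.1 + t • p.2) := by
  have h1 := ae_all_iff.2 fun i ↦ (hDg i).eq_integral
  have h2 := ae_ae_add_smul_notMem (ae_iff.1 hF)
  filter_upwards [h1, h2] with p hp1 hp2
  -- On a probability space Cauchy–Schwarz for the segment integral costs no constant.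
  have : IsProbabilityMeasure (volume.restrict (Set.Ioc (0 : ℝ) 1)) := ⟨by simp⟩
  have hint i : Integrable (fun t : ℝ ↦ (inner ℝ p.2 (Dg i (p.1 + t • p.2)) : ℝ))
      (volume.restrict (Set.Ioc (0 : ℝ) 1)) :=
    (intervalIntegrable_iff_integrableOn_Ioc_of_le zero_le_one).1 (hp1 i).1
  have hpt (x : ℝ) : ENNReal.ofReal (x ^ 2) = ‖x‖ₑ ^ 2 := by
    rw [← sq_abs, ENNReal.ofReal_pow (abs_nonneg _), ← Real.norm_eq_abs, ofReal_norm]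
  calc ENNReal.ofReal (‖g (p.1 + p.2) - g p.1‖ ^ 2)
      = ∑ i, ‖g (p.1 + p.2) i - g p.1 i‖ₑ ^ 2 := by
        rw [EuclideanSpace.real_norm_sq_eq, ENNReal.ofReal_sum_of_nonneg (fun _ _ ↦ sq_nonneg _)]
        exact Finset.sum_congr rfl fun i _ ↦ hpt _
    _ ≤ ∑ i, ∫⁻ t in Set.Ioc (0 : ℝ) 1, ‖(inner ℝ p.2 (Dg i (p.1 + t • p.2)) : ℝ)‖ₑ ^ 2 := by
        refine Finset.sum_le_sum fun i _ ↦ ?_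
        refine le_trans ?_ (sq_lintegral_enorm_le (hint i).1)
        rw [(hp1 i).2, intervalIntegral.integral_of_le zero_le_one]
        gcongr
        exact enorm_integral_le_lintegral_enorm _
    _ = ∫⁻ t in Set.Ioc (0 : ℝ) 1, ∑ i, ‖(inner ℝ p.2 (Dg i (p.1 + t • p.2)) : ℝ)‖ₑ ^ 2 :=
        (lintegral_finsetSum' _ fun i _ ↦ (hint i).1.enorm.pow_const 2).symm
    _ ≤ ∫⁻ t in Set.Ioc (0 : ℝ) 1, ENNReal.ofReal (‖p.2‖ ^ 2) * F (p.1 + t • p.2) := by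
        refine lintegral_mono_ae ?_
        filter_upwards [ae_restrict_of_ae hp2] with t ht
        simp only [not_not] at ht
        rw [← ht, ← ENNReal.ofReal_mul (sq_nonneg _)]
        simp_rw [← hpt]
        rw [← ENNReal.ofReal_sum_of_nonneg (fun _ _ ↦ sq_nonneg _)]
        exact ENNReal.ofReal_le_ofReal (sum_sq_inner_le_frobeniusSq Dg _ _)
    _ = _ := lintegral_const_mul' _ _ ENNReal.ofReal_ne_top

/-! ### Uniform `L²` bound for the normalized increment. -/

lemma lintegral_norm_pow_mul_norm_pow_lt_top {n : ℕ} (θ : EuclideanSpace ℝ (Fin n)) (σ : ℝ)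
    (p q : ℕ) :
    ∫⁻ x, ENNReal.ofReal (‖x.2‖ ^ p * (1 + ‖x.1 - θ‖) ^ q)
      ∂((isoGaussian θ σ).prod (isoGaussian (0 : EuclideanSpace ℝ (Fin n)) σ)) < ∞ := by
  have h1 : Integrable (fun y : EuclideanSpace ℝ (Fin n) ↦ (1 + ‖y - θ‖) ^ q)
      (isoGaussian θ σ) := by
    have hid : MemLp (fun y : EuclideanSpace ℝ (Fin n) ↦ y) q (isoGaussian θ σ) :=
      IsGaussian.memLp_id (isoGaussian θ σ) q (ENNReal.natCast_ne_top q)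
    have hsub : MemLp (fun y : EuclideanSpace ℝ (Fin n) ↦ y - θ) q (isoGaussian θ σ) :=
      hid.sub (memLp_const θ)
    have hone : MemLp (fun _ : EuclideanSpace ℝ (Fin n) ↦ (1 : ℝ)) q (isoGaussian θ σ) :=
      memLp_const 1
    have h : MemLp (fun y : EuclideanSpace ℝ (Fin n) ↦ 1 + ‖y - θ‖) q (isoGaussian θ σ) :=
      hone.add hsub.norm
    refine h.integrable_norm_pow'.congr (.of_forall fun y ↦ ?_)
    simp only [Real.norm_eq_abs]
    rw [abs_of_nonneg (by positivity)]
  have h2 : Integrable (fun w : EuclideanSpace ℝ (Fin n) ↦ ‖w‖ ^ p) (isoGaussian 0 σ) :=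
    (IsGaussian.memLp_id (isoGaussian 0 σ) p (ENNReal.natCast_ne_top p)).integrable_norm_pow'
  refine (Integrable.lintegral_lt_top ((h1.mul_prod h2).congr (.of_forall fun x ↦ ?_)))
  simp only; ring

lemma pow_four_norm_sub_le {E : Type*} [SeminormedAddCommGroup E] (a b : E) :
    ‖a - b‖ ^ 4 ≤ 8 * (‖a‖ ^ 4 + ‖b‖ ^ 4) := by
  have h : ‖a - b‖ ^ 4 ≤ (‖a‖ + ‖b‖) ^ 4 := by gcongr; exact norm_sub_le a b
  refine h.trans ?_
  nlinarith [sq_nonneg (‖a‖ ^ 2 - ‖b‖ ^ 2), sq_nonneg (‖a‖ - ‖b‖), sq_nonneg (‖a‖ + ‖b‖),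
    mul_nonneg (sq_nonneg (‖a‖ - ‖b‖)) (sq_nonneg (‖a‖ + ‖b‖)),
    mul_nonneg (sq_nonneg (‖a‖ - ‖b‖)) (sq_nonneg (‖a‖ - ‖b‖)),
    mul_nonneg (sq_nonneg (‖a‖ - ‖b‖)) (mul_nonneg (norm_nonneg a) (norm_nonneg b))]

/-- The normalized increment `⟨w, g(y + √α w) - g(y)⟩ / √α`. -/
noncomputable def incrementQuotient {n : ℕ}
    (g : EuclideanSpace ℝ (Fin n) → EuclideanSpace ℝ (Fin n)) (α : ℝ)
    (p : EuclideanSpace ℝ (Fin n) × EuclideanSpace ℝ (Fin n)) : ℝ :=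
  (1 / √α) * inner ℝ p.2 (g (p.1 + √α • p.2) - g p.1)

@[fun_prop]
lemma measurable_incrementQuotient {n : ℕ}
    {g : EuclideanSpace ℝ (Fin n) → EuclideanSpace ℝ (Fin n)} (hg : Measurable g) (α : ℝ) :
    Measurable (incrementQuotient g α) := by
  unfold incrementQuotient
  fun_prop

lemma sq_incrementQuotient_le {n : ℕ} (g : EuclideanSpace ℝ (Fin n) → EuclideanSpace ℝ (Fin n))
    {α : ℝ} (hα : 0 < α) (p : EuclideanSpace ℝ (Fin n) × EuclideanSpace ℝ (Fin n)) :
    incrementQuotient g α p ^ 2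
      ≤ (1 / α) * ‖p.2‖ ^ 2 * ‖g (p.1 + √α • p.2) - g p.1‖ ^ 2 := by
  unfold incrementQuotient
  rw [mul_pow, div_pow, one_pow, Real.sq_sqrt hα.le, mul_assoc, ← mul_pow]
  gcongr ?_ * ?_
  exact sq_le_sq.2 (by
    rw [abs_of_nonneg (by positivity : 0 ≤ ‖p.2‖ * ‖g (p.1 + √α • p.2) - g p.1‖)]
    exact abs_real_inner_le_norm _ _)

/-- For large noise or data, the normalized increment is bounded by polynomial moments. -/
lemma sq_incrementQuotient_le_of_one_lt {n : ℕ}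
    (g : EuclideanSpace ℝ (Fin n) → EuclideanSpace ℝ (Fin n)) (θ : EuclideanSpace ℝ (Fin n))
    {α : ℝ} (hα : 0 < α) {p : EuclideanSpace ℝ (Fin n) × EuclideanSpace ℝ (Fin n)}
    (h : 1 < ‖√α • p.2‖ * (1 + ‖p.1 - θ‖)) :
    incrementQuotient g α p ^ 2
      ≤ ‖p.2‖ ^ 8 * (1 + ‖p.1 - θ‖) ^ 4
        + (8 * ‖g (p.1 + √α • p.2)‖ ^ 4 + 8 * ‖g p.1‖ ^ 4) := by
  refine (sq_incrementQuotient_le g hα p).trans ?_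
  have h4 := pow_four_norm_sub_le (g (p.1 + √α • p.2)) (g p.1)
  set d := ‖g (p.1 + √α • p.2) - g p.1‖
  set r := 1 + ‖p.1 - θ‖
  set w := ‖p.2‖
  have hn : ‖√α • p.2‖ = √α * w := by
    rw [norm_smul, Real.norm_eq_abs, abs_of_nonneg (Real.sqrt_nonneg _)]
  have h1 : 1 ≤ α * w ^ 2 * r ^ 2 := by
    have : 1 ≤ (‖√α • p.2‖ * r) ^ 2 := one_le_pow₀ h.le
    rwa [hn, mul_pow, mul_pow, Real.sq_sqrt hα.le] at this
  -- The singular factor is traded for polynomial growth; `w⁴r²d² ≤ w⁸r⁴ + d⁴` then produces the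
  -- exponents 8 and 4.
  have h2 : 1 / α ≤ w ^ 2 * r ^ 2 := by
    rw [div_le_iff₀ hα]; linarith
  have h3 : 1 / α * w ^ 2 * d ^ 2 ≤ (w ^ 2 * r ^ 2) * w ^ 2 * d ^ 2 := by gcongr
  nlinarith [sq_nonneg (w ^ 4 * r ^ 2 - d ^ 2), sq_nonneg (w ^ 4 * r ^ 2), sq_nonneg (d ^ 2)]

lemma aemeasurable_ofReal_frobeniusSq_jacobian {n : ℕ}
    {g : EuclideanSpace ℝ (Fin n) → EuclideanSpace ℝ (Fin n)}
    {Dg : Fin n → EuclideanSpace ℝ (Fin n) → EuclideanSpace ℝ (Fin n)}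
    (hDg : ∀ i, IsWeakGradient (fun y => g y i) (Dg i)) :
    AEMeasurable (fun y ↦ ENNReal.ofReal (frobeniusSq (jacobian Dg y))) volume := by
  refine AEMeasurable.ennreal_ofReal ?_
  unfold frobeniusSq jacobian
  refine Finset.aemeasurable_fun_sum _ fun i _ ↦ Finset.aemeasurable_fun_sum _ fun j _ ↦ ?_
  have := (hDg i).aestronglyMeasurable.aemeasurable
  exact (((by fun_prop : Measurable fun x : EuclideanSpace ℝ (Fin n) ↦ x j).comp_aemeasurable
    this).pow_const 2)

/-- The normalized increment is bounded in `L²`, uniformly over small `α`. -/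
lemma exists_lintegral_sq_incrementQuotient_le {n : ℕ} {σ : ℝ} (hσ : 0 < σ)
    (θ : EuclideanSpace ℝ (Fin n))
    {g : EuclideanSpace ℝ (Fin n) → EuclideanSpace ℝ (Fin n)} (hg : Measurable g)
    {Dg : Fin n → EuclideanSpace ℝ (Fin n) → EuclideanSpace ℝ (Fin n)}
    (hDg : ∀ i, IsWeakGradient (fun y => g y i) (Dg i))
    (hDg2 : ∫⁻ y, ENNReal.ofReal (frobeniusSq (jacobian Dg y)) ∂isoGaussian θ σ < ∞)
    {α₀ : ℝ} {C : ℝ≥0∞} (hC : C < ∞)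
    (hU : ∀ α ∈ Set.Ioc 0 α₀, ∫⁻ p, ENNReal.ofReal (‖g (p.1 + √α • p.2)‖ ^ 4)
      ∂((isoGaussian θ σ).prod (isoGaussian 0 σ)) ≤ C)
    (hg4 : ∫⁻ y, ENNReal.ofReal (‖g y‖ ^ 4) ∂isoGaussian θ σ < ∞) :
    ∃ C' : ℝ≥0∞, C' < ∞ ∧ ∀ α ∈ Set.Ioc 0 α₀,
      ∫⁻ p, ENNReal.ofReal (incrementQuotient g α p ^ 2)
        ∂((isoGaussian θ σ).prod (isoGaussian 0 σ)) ≤ C' := by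
  -- `F` is a measurable representative of the squared Frobenius norm, as Tonelli requires.
  have hae := aemeasurable_ofReal_frobeniusSq_jacobian hDg
  set F := hae.mk
  have hFm : Measurable F := hae.measurable_mk
  have hF := hae.ae_eq_mk
  have hF2 : ∫⁻ y, F y ∂isoGaussian θ σ < ∞ := by
    rwa [← lintegral_congr_ae ((isoGaussian_absolutelyContinuous θ hσ).ae_eq hF)]
  set γ := isoGaussian θ σ
  set η : Measure (EuclideanSpace ℝ (Fin n)) := isoGaussian 0 σ
  -- The first summand comes from the region of small shifts, the others from its complement.
  refine ⟨ENNReal.ofReal (Real.exp (2 / σ ^ 2)) * (∫⁻ y, F y ∂γ)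
      * (∫⁻ w, ENNReal.ofReal (‖w‖ ^ 4) ∂η)
    + ((∫⁻ x, ENNReal.ofReal (‖x.2‖ ^ 8 * (1 + ‖x.1 - θ‖) ^ 4) ∂(γ.prod η))
      + (8 * C + 8 * ∫⁻ y, ENNReal.ofReal (‖g y‖ ^ 4) ∂γ)), ?_, fun α hα ↦ ?_⟩
  · have h1 := lintegral_norm_pow_isoGaussian_lt_top (0 : EuclideanSpace ℝ (Fin n)) σ 4
    have h2 := lintegral_norm_pow_mul_norm_pow_lt_top θ σ 8 4
    finiteness
  have hα0 : 0 < α := hα.1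
  have hB : MeasurableSet {q : (EuclideanSpace ℝ (Fin n) × EuclideanSpace ℝ (Fin n)) × ℝ |
      ‖q.2 • √α • q.1.2‖ * (1 + ‖q.1.1 - θ‖) ≤ 1} :=
    measurableSet_le (by fun_prop) (by fun_prop)
  set W : (EuclideanSpace ℝ (Fin n) × EuclideanSpace ℝ (Fin n)) × ℝ → ℝ≥0∞ := fun q ↦
    ENNReal.ofReal (‖q.1.2‖ ^ 4) *
      {y | ‖q.2 • √α • q.1.2‖ * (1 + ‖y - θ‖) ≤ 1}.indicator
        (fun y ↦ F (y + q.2 • √α • q.1.2)) q.1.1 with hWdef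
  have hWm : Measurable W := by
    refine Measurable.mul (by fun_prop) ?_
    exact Measurable.indicator (f := fun q : (EuclideanSpace ℝ (Fin n) ×
      EuclideanSpace ℝ (Fin n)) × ℝ ↦ F (q.1.1 + q.2 • √α • q.1.2)) (by fun_prop) hB
  have hWint : ∫⁻ p, (∫⁻ t in Set.Ioc (0 : ℝ) 1, W (p, t)) ∂(γ.prod η)
      ≤ ENNReal.ofReal (Real.exp (2 / σ ^ 2)) * (∫⁻ y, F y ∂γ)
        * (∫⁻ w, ENNReal.ofReal (‖w‖ ^ 4) ∂η) := by
    -- With `t` and `w` frozen, the integral over `y` is a Gaussian integral translated by `t √α w`,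
    -- and the indicator keeps only those `y` for which this translation is harmless.
    rw [lintegral_lintegral_swap (f := fun p t ↦ W (p, t)) hWm.aemeasurable]
    calc _ ≤ ∫⁻ t in Set.Ioc (0 : ℝ) 1, ENNReal.ofReal (Real.exp (2 / σ ^ 2)) * (∫⁻ y, F y ∂γ)
        * (∫⁻ w, ENNReal.ofReal (‖w‖ ^ 4) ∂η) := by
          refine lintegral_mono fun t ↦ ?_
          rw [lintegral_prod_symm _ (by fun_prop), ← lintegral_const_mul _ (by fun_prop)]
          refine lintegral_mono fun w ↦ ?_
          simp only [hWdef]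
          rw [lintegral_const_mul' _ _ ENNReal.ofReal_ne_top, mul_comm]
          gcongr
          exact lintegral_isoGaussian_indicator_add_le θ hσ (t • √α • w) hFm
      _ = _ := by simp
  have hae1 := (quasiMeasurePreserving_prod_smul θ hσ (Real.sqrt_pos.2 hα0).ne').ae
    (ae_ofReal_norm_sub_sq_le hDg hF)
  have hpt : ∀ᵐ p ∂(γ.prod η), ENNReal.ofReal (incrementQuotient g α p ^ 2)
      ≤ (∫⁻ t in Set.Ioc (0 : ℝ) 1, W (p, t))
        + (ENNReal.ofReal (‖p.2‖ ^ 8 * (1 + ‖p.1 - θ‖) ^ 4)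
          + (8 * ENNReal.ofReal (‖g (p.1 + √α • p.2)‖ ^ 4)
            + 8 * ENNReal.ofReal (‖g p.1‖ ^ 4))) := by
    filter_upwards [hae1] with p hp
    by_cases hcase : ‖√α • p.2‖ * (1 + ‖p.1 - θ‖) ≤ 1
    · refine le_add_right ?_
      -- The cutoff at the full shift implies the one at every `t ≤ 1`.
      have hW : ∀ t ∈ Set.Ioc (0 : ℝ) 1,
          W (p, t) = ENNReal.ofReal (‖p.2‖ ^ 4) * F (p.1 + t • √α • p.2) := by
        intro t ht
        simp only [hWdef]
        rw [Set.indicator_of_mem]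
        rw [Set.mem_ofPred_eq, norm_smul, Real.norm_eq_abs, abs_of_pos ht.1]
        refine le_trans ?_ hcase
        gcongr
        exact mul_le_of_le_one_left (norm_nonneg _) ht.2
      rw [setLIntegral_congr_fun measurableSet_Ioc hW,
        lintegral_const_mul' _ _ ENNReal.ofReal_ne_top]
      calc _ ≤ ENNReal.ofReal ((1 / α) * ‖p.2‖ ^ 2 * ‖g (p.1 + √α • p.2) - g p.1‖ ^ 2) :=
            ENNReal.ofReal_le_ofReal (sq_incrementQuotient_le g hα0 p)
        _ = ENNReal.ofReal ((1 / α) * ‖p.2‖ ^ 2)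
            * ENNReal.ofReal (‖g (p.1 + √α • p.2) - g p.1‖ ^ 2) :=
            ENNReal.ofReal_mul (by positivity)
        _ ≤ ENNReal.ofReal ((1 / α) * ‖p.2‖ ^ 2) * (ENNReal.ofReal (‖√α • p.2‖ ^ 2) *
              ∫⁻ t in Set.Ioc (0 : ℝ) 1, F (p.1 + t • √α • p.2)) := by gcongr
        _ = _ := by
            -- The factor `α` in `‖√α w‖²` cancels `1/α`.
            rw [← mul_assoc, ← ENNReal.ofReal_mul (by positivity)]
            congr 2
            rw [norm_smul, Real.norm_eq_abs, abs_of_nonneg (Real.sqrt_nonneg _), mul_pow,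
              Real.sq_sqrt hα0.le]
            field_simp
    · refine le_add_left ?_
      refine (ENNReal.ofReal_le_ofReal
        (sq_incrementQuotient_le_of_one_lt g θ hα0 (not_le.1 hcase))).trans_eq ?_
      rw [ENNReal.ofReal_add (by positivity) (by positivity),
        ENNReal.ofReal_add (by positivity) (by positivity), ENNReal.ofReal_mul (p := 8) (by norm_num),
        ENNReal.ofReal_mul (p := 8) (by norm_num), ENNReal.ofReal_ofNat]
  refine (lintegral_mono_ae hpt).trans ?_
  rw [lintegral_add_right _ (by fun_prop), lintegral_add_left (by fun_prop),
    lintegral_add_left (by fun_prop), lintegral_const_mul _ (by fun_prop),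
    lintegral_const_mul _ (by fun_prop)]
  gcongr
  · exact hU α hα
  · rw [lintegral_prod _ (by fun_prop)]
    simp

/-! ### Second moments of sums of i.i.d. variables. -/

lemma memLp_two_of_lintegral_sq_lt_top {X : Type*} [MeasurableSpace X] {μ : Measure X}
    {f : X → ℝ} (hf : AEStronglyMeasurable f μ)
    (h : ∫⁻ x, ENNReal.ofReal (f x ^ 2) ∂μ < ∞) : MemLp f 2 μ := by
  rw [memLp_two_iff_integrable_sq hf]
  exact ⟨hf.pow 2, (hasFiniteIntegral_iff_ofReal (.of_forall fun x ↦ sq_nonneg (f x))).2 h⟩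

lemma lintegral_sq_eq_variance_add {X : Type*} [MeasurableSpace X] {μ : Measure X}
    [IsProbabilityMeasure μ] {f : X → ℝ} (hf : MemLp f 2 μ) :
    ∫⁻ x, ENNReal.ofReal (f x ^ 2) ∂μ = ENNReal.ofReal (Var[f; μ] + (∫ x, f x ∂μ) ^ 2) := by
  rw [← ofReal_integral_eq_lintegral_ofReal hf.integrable_sq (.of_forall fun x ↦ sq_nonneg (f x)),
    variance_eq_sub hf]
  simp

/-- If a sum of i.i.d. random variables is square integrable, then so is each summand. -/
lemma memLp_two_of_lintegral_sq_sum_pi_lt_top {X : Type*} [MeasurableSpace X] {η : Measure X}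
    [IsProbabilityMeasure η] {m : ℕ} {h : X → ℝ} (hh : Measurable h)
    (hfin : ∫⁻ w, ENNReal.ofReal ((∑ k, h (w k)) ^ 2)
      ∂(Measure.pi fun _ : Fin (m + 1) ↦ η) < ∞) : MemLp h 2 η := by
  have hmp := (measurePreserving_piFinSuccAbove (fun _ : Fin (m + 1) ↦ η) 0).symm
  rw [← hmp.lintegral_comp (by fun_prop)] at hfin
  rw [lintegral_prod_symm _ (by fun_prop)] at hfin
  -- By Tonelli some choice `r` of the remaining coordinates makes the section square integrable;
  -- given `r`, their sum is a constant to subtract.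
  obtain ⟨r, hr⟩ := (ae_lt_top' (by fun_prop) hfin.ne).exists
  have hsum : MemLp (fun x ↦ h x + ∑ k, h (r k)) 2 η := by
    refine memLp_two_of_lintegral_sq_lt_top (by fun_prop) ?_
    convert hr using 5 with x
    simp [Fin.sum_univ_succ]
  have := hsum.sub (memLp_const (∑ k, h (r k)))
  refine this.congr_norm (by fun_prop) (.of_forall fun x ↦ ?_)
  simp

/-- The second moment of a sum of i.i.d. random variables dominates that of one summand. -/
lemma lintegral_sq_le_lintegral_sq_sum_pi {X : Type*} [MeasurableSpace X] {η : Measure X}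
    [IsProbabilityMeasure η] {K : ℕ} (hK : 0 < K) {h : X → ℝ} (hh : Measurable h) :
    ∫⁻ w, ENNReal.ofReal (h w ^ 2) ∂η
      ≤ ∫⁻ w, ENNReal.ofReal ((∑ k, h (w k)) ^ 2) ∂(Measure.pi fun _ : Fin K ↦ η) := by
  obtain ⟨m, rfl⟩ : ∃ m, K = m + 1 := ⟨K - 1, by omega⟩
  rcases eq_or_ne (∫⁻ w, ENNReal.ofReal ((∑ k, h (w k)) ^ 2)
    ∂(Measure.pi fun _ : Fin (m + 1) ↦ η)) ∞ with htop | htop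
  · simp [htop]
  have hL := memLp_two_of_lintegral_sq_sum_pi_lt_top hh htop.lt_top
  have hLk (k : Fin (m + 1)) : MemLp (fun w : Fin (m + 1) → X ↦ h (w k)) 2
      (Measure.pi fun _ ↦ η) :=
    hL.comp_measurePreserving (measurePreserving_eval (fun _ ↦ η) k)
  have hS : MemLp (fun w : Fin (m + 1) → X ↦ ∑ k, h (w k)) 2 (Measure.pi fun _ ↦ η) :=
    memLp_finsetSum _ fun k _ ↦ hLk k
  rw [lintegral_sq_eq_variance_add hL, lintegral_sq_eq_variance_add hS]
  have hvar : Var[fun w : Fin (m + 1) → X ↦ ∑ k, h (w k); Measure.pi fun _ ↦ η]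
      = (m + 1) * Var[h; η] := by
    have := variance_sum_pi (μ := fun _ : Fin (m + 1) ↦ η) (X := fun _ ↦ h) fun _ ↦ hL
    rw [Finset.sum_fn] at this
    simpa using this
  have hint : ∫ w : Fin (m + 1) → X, ∑ k, h (w k) ∂(Measure.pi fun _ ↦ η)
      = (m + 1) * ∫ x, h x ∂η := by
    rw [integral_finsetSum _ fun k _ ↦ (hLk k).integrable (by norm_num)]
    have (k : Fin (m + 1)) : ∫ w : Fin (m + 1) → X, h (w k) ∂(Measure.pi fun _ ↦ η)
        = ∫ x, h x ∂η := by
      exact integral_comp_eval (μ := fun _ : Fin (m + 1) ↦ η) (i := k) (by fun_prop)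
    simp [this]
  rw [hvar, hint]
  have hv := variance_nonneg h η
  have hm : (0 : ℝ) ≤ m := m.cast_nonneg
  -- With `K = m + 1`, `K Var + K² mean²` dominates `Var + mean²`.
  refine ENNReal.ofReal_le_ofReal ?_
  rw [mul_pow]
  nlinarith [sq_nonneg (∫ x, h x ∂η), mul_nonneg hm hv,
    mul_nonneg (by nlinarith : (0 : ℝ) ≤ (m + 1) ^ 2 - 1) (sq_nonneg (∫ x, h x ∂η))]

/-! ### Fourth moments of `g` at perturbed data. -/

@[fun_prop]
lemma measurable_foldEstimate {n : ℕ} {g : EuclideanSpace ℝ (Fin n) → EuclideanSpace ℝ (Fin n)}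
    (hg : Measurable g) (α : ℝ) :
    Measurable fun p : EuclideanSpace ℝ (Fin n) × EuclideanSpace ℝ (Fin n) ↦
      foldEstimate g α p.1 p.2 := by
  unfold foldEstimate
  fun_prop

/-- `g(train)` is the test vector minus the residual, and the squared residual is the fold plus
`‖w‖²/α`. Two uses of the factor 8 give 64, and `80 = 64 + 16` collects both noise contributions. -/
lemma norm_pow_four_le_foldEstimate {n : ℕ}
    (g : EuclideanSpace ℝ (Fin n) → EuclideanSpace ℝ (Fin n)) {α : ℝ} (hα : 0 < α)
    (y w : EuclideanSpace ℝ (Fin n)) :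
    ‖g (y + √α • w)‖ ^ 4 ≤ 64 * ‖y‖ ^ 4 + (80 / α ^ 2 * ‖w‖ ^ 4 + 16 * foldEstimate g α y w ^ 2) := by
  have h1 := pow_four_norm_sub_le (y - (1 / √α) • w) (y - (1 / √α) • w - g (y + √α • w))
  rw [sub_sub_cancel] at h1
  have h2 := pow_four_norm_sub_le y ((1 / √α) • w)
  have h3 : ‖(1 / √α) • w‖ ^ 4 = 1 / α ^ 2 * ‖w‖ ^ 4 := by
    rw [norm_smul, mul_pow, Real.norm_eq_abs, abs_of_nonneg (by positivity), div_pow,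
      show (√α) ^ 4 = ((√α) ^ 2) ^ 2 by ring, Real.sq_sqrt hα.le, one_pow]
  have h4 : ‖y - (1 / √α) • w - g (y + √α • w)‖ ^ 2
      = foldEstimate g α y w + (1 / α) * ‖w‖ ^ 2 := by
    unfold foldEstimate; ring
  have h5 : ‖y - (1 / √α) • w - g (y + √α • w)‖ ^ 4
      ≤ 2 * foldEstimate g α y w ^ 2 + 2 * (1 / α ^ 2 * ‖w‖ ^ 4) := by
    rw [show ‖y - (1 / √α) • w - g (y + √α • w)‖ ^ 4
      = (‖y - (1 / √α) • w - g (y + √α • w)‖ ^ 2) ^ 2 by ring, h4]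
    have : 1 / α ^ 2 * ‖w‖ ^ 4 = ((1 / α) * ‖w‖ ^ 2) ^ 2 := by ring
    rw [this]
    nlinarith [sq_nonneg (foldEstimate g α y w - (1 / α) * ‖w‖ ^ 2)]
  rw [h3] at h2
  have h6 : 80 / α ^ 2 * ‖w‖ ^ 4 = 80 * (1 / α ^ 2 * ‖w‖ ^ 4) := by ring
  linarith

lemma lintegral_sq_sum_lt_top {X : Type*} [MeasurableSpace X] {μ : Measure X}
    [IsProbabilityMeasure μ] {K : ℕ} (hK : 0 < K) {f : Fin K → X → ℝ} (c : ℝ)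
    (hfin : ∫⁻ x, ENNReal.ofReal (((1 / (K : ℝ)) * ∑ k, f k x - c) ^ 2) ∂μ < ∞) :
    ∫⁻ x, ENNReal.ofReal ((∑ k, f k x) ^ 2) ∂μ < ∞ := by
  have hK0 : (0 : ℝ) < K := by exact_mod_cast hK
  have hle : ∫⁻ x, ENNReal.ofReal ((∑ k, f k x) ^ 2) ∂μ ≤
      ∫⁻ x, (ENNReal.ofReal (2 * K ^ 2) *
        ENNReal.ofReal (((1 / (K : ℝ)) * ∑ k, f k x - c) ^ 2)
        + ENNReal.ofReal (2 * K ^ 2 * c ^ 2)) ∂μ := by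
    refine lintegral_mono fun x ↦ ?_
    rw [← ENNReal.ofReal_mul (by positivity),
      ← ENNReal.ofReal_add (by positivity) (by positivity)]
    refine ENNReal.ofReal_le_ofReal ?_
    set S := ∑ k, f k x
    have hS : S = K * (1 / K * S - c) + K * c := by field_simp; ring
    set D := 1 / K * S - c
    rw [hS]
    nlinarith [sq_nonneg (K * D - K * c)]
  refine hle.trans_lt ?_
  rw [lintegral_add_right _ (by fun_prop), lintegral_const_mul' _ _ ENNReal.ofReal_ne_top]
  simp only [lintegral_const, measure_univ, mul_one]
  exact ENNReal.add_lt_top.2 ⟨ENNReal.mul_lt_top ENNReal.ofReal_lt_top hfin, ENNReal.ofReal_lt_top⟩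

lemma lintegral_prod_fst {X Z : Type*} [MeasurableSpace X] [MeasurableSpace Z] {μ : Measure X}
    {ν : Measure Z} [SFinite μ] [IsProbabilityMeasure ν] {f : X → ℝ≥0∞} (hf : Measurable f) :
    ∫⁻ p, f p.1 ∂(μ.prod ν) = ∫⁻ x, f x ∂μ := by
  rw [lintegral_prod _ (by fun_prop)]
  simp only [lintegral_const, measure_univ, mul_one]

lemma lintegral_prod_snd {X Z : Type*} [MeasurableSpace X] [MeasurableSpace Z] {μ : Measure X}
    {ν : Measure Z} [IsProbabilityMeasure μ] [SFinite ν] {f : Z → ℝ≥0∞} (hf : Measurable f) :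
    ∫⁻ p, f p.2 ∂(μ.prod ν) = ∫⁻ x, f x ∂ν := by
  rw [lintegral_prod _ (by fun_prop)]
  simp only [lintegral_const, measure_univ, mul_one]

lemma measurable_uncurry_eval {X Z : Type*} [MeasurableSpace X] [MeasurableSpace Z] {K : ℕ}
    {f : X → Z → ℝ} (hf : Measurable fun p : X × Z ↦ f p.1 p.2) (k : Fin K) :
    Measurable fun p : X × (Fin K → Z) ↦ f p.1 (p.2 k) :=
  hf.comp (by fun_prop : Measurable fun p : X × (Fin K → Z) ↦ (p.1, p.2 k))

/-- If an average of conditionally i.i.d. variables is square integrable, then so is each of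
them. -/
lemma lintegral_sq_lt_top_of_average {X Z : Type*} [MeasurableSpace X] [MeasurableSpace Z]
    {μ : Measure X} {η : Measure Z} [IsProbabilityMeasure μ] [IsProbabilityMeasure η]
    {K : ℕ} (hK : 0 < K) {f : X → Z → ℝ} (hf : Measurable fun p : X × Z ↦ f p.1 p.2) (c : ℝ)
    (hfin : ∫⁻ p, ENNReal.ofReal (((1 / (K : ℝ)) * ∑ k, f p.1 (p.2 k) - c) ^ 2)
      ∂(μ.prod (Measure.pi fun _ : Fin K ↦ η)) < ∞) :
    ∫⁻ p, ENNReal.ofReal (f p.1 p.2 ^ 2) ∂(μ.prod η) < ∞ := by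
  have hmk (k : Fin K) := measurable_uncurry_eval hf k
  have h1 := lintegral_sq_sum_lt_top hK (f := fun k (p : X × (Fin K → Z)) ↦ f p.1 (p.2 k)) c hfin
  refine lt_of_le_of_lt ?_ h1
  rw [lintegral_prod _ (by fun_prop), lintegral_prod _ (by fun_prop)]
  -- For fixed data `y` the folds are i.i.d.
  refine lintegral_mono fun y ↦ ?_
  exact lintegral_sq_le_lintegral_sq_sum_pi hK (h := fun w ↦ f y w)
    (hf.comp (by fun_prop : Measurable fun w ↦ (y, w)))

/-- If the coupled bootstrap estimator is square integrable, then `g` has a finite fourth moment at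
the perturbed data. -/
lemma lintegral_norm_pow_four_lt_top_of_foldEstimate {n K : ℕ} (hK : 0 < K) {σ : ℝ}
    (θ : EuclideanSpace ℝ (Fin n)) {g : EuclideanSpace ℝ (Fin n) → EuclideanSpace ℝ (Fin n)}
    (hg : Measurable g) {α : ℝ} (hα : 0 < α) (c : ℝ)
    (hfin : ∫⁻ p, ENNReal.ofReal (((1 / (K : ℝ)) * ∑ k, foldEstimate g α p.1 (p.2 k) - c) ^ 2)
      ∂((isoGaussian θ σ).prod
        (Measure.pi fun _ : Fin K ↦ isoGaussian (0 : EuclideanSpace ℝ (Fin n)) σ)) < ∞) :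
    ∫⁻ p, ENNReal.ofReal (‖g (p.1 + √α • p.2)‖ ^ 4)
      ∂((isoGaussian θ σ).prod (isoGaussian 0 σ)) < ∞ := by
  have h2 := lintegral_sq_lt_top_of_average hK (measurable_foldEstimate hg α) c hfin
  have hy := lintegral_norm_pow_isoGaussian_lt_top θ σ 4
  have hw := lintegral_norm_pow_isoGaussian_lt_top (0 : EuclideanSpace ℝ (Fin n)) σ 4
  have hle : ∫⁻ p, ENNReal.ofReal (‖g (p.1 + √α • p.2)‖ ^ 4)
      ∂((isoGaussian θ σ).prod (isoGaussian 0 σ))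
      ≤ ∫⁻ p, (ENNReal.ofReal 64 * ENNReal.ofReal (‖p.1‖ ^ 4)
        + (ENNReal.ofReal (80 / α ^ 2) * ENNReal.ofReal (‖p.2‖ ^ 4)
          + ENNReal.ofReal 16 * ENNReal.ofReal (foldEstimate g α p.1 p.2 ^ 2)))
        ∂((isoGaussian θ σ).prod (isoGaussian 0 σ)) := by
    refine lintegral_mono fun p ↦ (ENNReal.ofReal_le_ofReal
      (norm_pow_four_le_foldEstimate g hα p.1 p.2)).trans_eq ?_
    rw [ENNReal.ofReal_add (by positivity) (by positivity),
      ENNReal.ofReal_add (by positivity) (by positivity), ENNReal.ofReal_mul (by positivity),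
      ENNReal.ofReal_mul (by positivity), ENNReal.ofReal_mul (by positivity)]
  refine hle.trans_lt ?_
  rw [lintegral_add_left (by fun_prop), lintegral_add_left (by fun_prop),
    lintegral_const_mul' _ _ ENNReal.ofReal_ne_top,
    lintegral_const_mul' _ _ ENNReal.ofReal_ne_top,
    lintegral_const_mul' _ _ ENNReal.ofReal_ne_top,
    lintegral_prod_fst (f := fun y : EuclideanSpace ℝ (Fin n) ↦ ENNReal.ofReal (‖y‖ ^ 4))
      (by fun_prop),
    lintegral_prod_snd (f := fun y : EuclideanSpace ℝ (Fin n) ↦ ENNReal.ofReal (‖y‖ ^ 4))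
      (by fun_prop)]
  exact ENNReal.add_lt_top.2 ⟨ENNReal.mul_lt_top ENNReal.ofReal_lt_top hy,
    ENNReal.add_lt_top.2 ⟨ENNReal.mul_lt_top ENNReal.ofReal_lt_top hw,
      ENNReal.mul_lt_top ENNReal.ofReal_lt_top h2⟩⟩

/-- The fourth moment of `g` at the perturbed data is bounded uniformly over small `α`. -/
lemma exists_lintegral_norm_pow_four_le {n : ℕ} {σ : ℝ} (hσ : 0 < σ)
    (θ : EuclideanSpace ℝ (Fin n)) {g : EuclideanSpace ℝ (Fin n) → EuclideanSpace ℝ (Fin n)}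
    (hg : Measurable g) {α₀ : ℝ} (hα₀ : 0 < α₀)
    (hfin : ∫⁻ p, ENNReal.ofReal (‖g (p.1 + √α₀ • p.2)‖ ^ 4)
      ∂((isoGaussian θ σ).prod (isoGaussian 0 σ)) < ∞) :
    ∃ C : ℝ≥0∞, C < ∞ ∧ ∀ α ∈ Set.Ioc 0 α₀,
      ∫⁻ p, ENNReal.ofReal (‖g (p.1 + √α • p.2)‖ ^ 4)
        ∂((isoGaussian θ σ).prod (isoGaussian 0 σ)) ≤ C := by
  have hmap {α : ℝ} (hα : 0 ≤ α) : ∫⁻ p, ENNReal.ofReal (‖g (p.1 + √α • p.2)‖ ^ 4)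
        ∂((isoGaussian θ σ).prod (isoGaussian 0 σ))
      = ∫⁻ u, ENNReal.ofReal (‖g u‖ ^ 4) ∂isoGaussian θ (√(1 + α) * σ) := by
    rw [← map_add_smul_isoGaussian θ σ hα, lintegral_map (by fun_prop) (by fun_prop)]
  rw [hmap hα₀.le] at hfin
  refine ⟨_, ENNReal.mul_lt_top (ENNReal.ofReal_lt_top
    (r := (2 * Real.pi * (√(1 + α₀) * σ) ^ 2) ^ ((n : ℝ) / 2)
      / (2 * Real.pi * σ ^ 2) ^ ((n : ℝ) / 2))) hfin, fun α hα ↦ ?_⟩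
  rw [hmap hα.1.le]
  refine lintegral_isoGaussian_le θ hσ ?_ ?_ (by fun_prop)
  · refine le_mul_of_one_le_left hσ.le ?_
    rw [Real.one_le_sqrt]
    linarith [hα.1]
  · gcongr
    exact hα.2

/-! ### Splitting the estimators into a bounded and a singular part. -/

/-- The cross term is split at `g y`, which isolates a singular term linear in `w`. -/
lemma foldEstimate_eq {n : ℕ} (g : EuclideanSpace ℝ (Fin n) → EuclideanSpace ℝ (Fin n))
    {α : ℝ} (hα : 0 < α) (y w : EuclideanSpace ℝ (Fin n)) :
    foldEstimate g α y w = ‖y - g (y + √α • w)‖ ^ 2 + 2 * incrementQuotient g α (y, w)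
      - (2 / √α) * inner ℝ w (y - g y) := by
  unfold foldEstimate incrementQuotient
  simp only
  set u := g (y + √α • w)
  have h1 : y - (1 / √α) • w - u = (y - u) - (1 / √α) • w := by abel
  have h2 : u - g y = (y - g y) - (y - u) := by abel
  rw [h1, norm_sub_sq_real, h2, inner_sub_right, inner_smul_right, norm_smul, mul_pow,
    Real.norm_eq_abs, sq_abs, div_pow, Real.sq_sqrt hα.le, real_inner_comm w (y - u)]
  ring

/-- The average over the folds of the bounded part of the estimators. -/
noncomputable def foldRemainder {Ω : Type*} {n K : ℕ}
    (g : EuclideanSpace ℝ (Fin n) → EuclideanSpace ℝ (Fin n)) (α : ℝ)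
    (Y : Ω → EuclideanSpace ℝ (Fin n)) (ω : Fin K → Ω → EuclideanSpace ℝ (Fin n)) (x : Ω) : ℝ :=
  (1 / (K : ℝ)) * ∑ k, (‖Y x - g (Y x + √α • ω k x)‖ ^ 2
    + 2 * incrementQuotient g α (Y x, ω k x))

lemma randomizedEstimator_eq {Ω : Type*} {n K : ℕ}
    (g : EuclideanSpace ℝ (Fin n) → EuclideanSpace ℝ (Fin n)) {α : ℝ} (hα : 0 < α)
    (Y : Ω → EuclideanSpace ℝ (Fin n)) (ω : Fin K → Ω → EuclideanSpace ℝ (Fin n)) (x : Ω) :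
    randomizedEstimator g α Y ω x = foldRemainder g α Y ω x
      - (2 / √α) * inner ℝ ((1 / (K : ℝ)) • ∑ k, ω k x) (Y x - g (Y x)) := by
  unfold randomizedEstimator foldRemainder
  simp_rw [foldEstimate_eq g hα]
  rw [Finset.sum_sub_distrib, mul_sub, inner_smul_left, sum_inner, ← Finset.mul_sum]
  simp only [conj_trivial]
  ring

/-- Cauchy–Schwarz over the folds, then `(a + 2Z - c)² ≤ 3a² + 12Z² + 3c²` with the fourth-power
bound multiplying 3 by 8. The factor `1/K` is dropped. -/
lemma sq_foldRemainder_sub_le {Ω : Type*} {n K : ℕ} (hK : 0 < K)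
    (g : EuclideanSpace ℝ (Fin n) → EuclideanSpace ℝ (Fin n)) (α : ℝ)
    (Y : Ω → EuclideanSpace ℝ (Fin n)) (ω : Fin K → Ω → EuclideanSpace ℝ (Fin n)) (x : Ω) (c : ℝ) :
    (foldRemainder g α Y ω x - c) ^ 2 ≤ ∑ k, (24 * ‖Y x‖ ^ 4
      + (24 * ‖g (Y x + √α • ω k x)‖ ^ 4
        + (12 * incrementQuotient g α (Y x, ω k x) ^ 2 + 3 * c ^ 2))) := by
  have hK1 : (1 : ℝ) ≤ K := by exact_mod_cast hK
  have h1 : foldRemainder g α Y ω x - c = (1 / (K : ℝ)) * ∑ k,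
      (‖Y x - g (Y x + √α • ω k x)‖ ^ 2 + 2 * incrementQuotient g α (Y x, ω k x) - c) := by
    unfold foldRemainder
    rw [Finset.sum_sub_distrib, mul_sub]
    simp only [Finset.sum_const, Finset.card_univ, Fintype.card_fin, nsmul_eq_mul]
    field_simp
  rw [h1, mul_pow]
  have h2 := sq_sum_le_card_mul_sum_sq (s := Finset.univ) (f := fun k : Fin K ↦
    (‖Y x - g (Y x + √α • ω k x)‖ ^ 2 + 2 * incrementQuotient g α (Y x, ω k x) - c))
  rw [Finset.card_univ, Fintype.card_fin] at h2
  have h3 : ∑ k : Fin K,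
      (‖Y x - g (Y x + √α • ω k x)‖ ^ 2 + 2 * incrementQuotient g α (Y x, ω k x) - c) ^ 2
      ≤ ∑ k, (24 * ‖Y x‖ ^ 4 + (24 * ‖g (Y x + √α • ω k x)‖ ^ 4
        + (12 * incrementQuotient g α (Y x, ω k x) ^ 2 + 3 * c ^ 2))) := by
    refine Finset.sum_le_sum fun k _ ↦ ?_
    have h4 := pow_four_norm_sub_le (Y x) (g (Y x + √α • ω k x))
    have h5 : (‖Y x - g (Y x + √α • ω k x)‖ ^ 2) ^ 2 = ‖Y x - g (Y x + √α • ω k x)‖ ^ 4 := by ring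
    set A := ‖Y x - g (Y x + √α • ω k x)‖ ^ 2
    set Z := incrementQuotient g α (Y x, ω k x)
    nlinarith [sq_nonneg (A - 2 * Z), sq_nonneg (A + c), sq_nonneg (2 * Z + c)]
  have h0 : 0 ≤ ∑ k : Fin K, (‖Y x - g (Y x + √α • ω k x)‖ ^ 2
      + 2 * incrementQuotient g α (Y x, ω k x) - c) ^ 2 :=
    Finset.sum_nonneg fun _ _ ↦ sq_nonneg _
  refine le_trans ?_ h3
  calc _ ≤ (1 / (K : ℝ)) ^ 2 * (K * ∑ k : Fin K, (‖Y x - g (Y x + √α • ω k x)‖ ^ 2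
      + 2 * incrementQuotient g α (Y x, ω k x) - c) ^ 2) := by gcongr
    _ = (1 / (K : ℝ)) * ∑ k : Fin K, (‖Y x - g (Y x + √α • ω k x)‖ ^ 2
      + 2 * incrementQuotient g α (Y x, ω k x) - c) ^ 2 := by field_simp
    _ ≤ _ := mul_le_of_le_one_left h0 (by rw [div_le_one (by linarith)]; exact hK1)

/-- The bounded part of the estimators is bounded in `L²`, uniformly over small `α`. -/
lemma exists_lintegral_sq_foldRemainder_le {Ω : Type*} [MeasurableSpace Ω] {P : Measure Ω}
    {n K : ℕ} (hK : 0 < K) {σ : ℝ} {θ : EuclideanSpace ℝ (Fin n)}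
    {Y : Ω → EuclideanSpace ℝ (Fin n)} {ω : Fin K → Ω → EuclideanSpace ℝ (Fin n)}
    (hlaw : ∀ k, HasLaw (fun x ↦ (Y x, ω k x)) ((isoGaussian θ σ).prod (isoGaussian 0 σ)) P)
    {g : EuclideanSpace ℝ (Fin n) → EuclideanSpace ℝ (Fin n)} (hg : Measurable g) (c : ℝ)
    {α₀ : ℝ} {C C' : ℝ≥0∞} (hC : C < ∞) (hC' : C' < ∞)
    (hU : ∀ α ∈ Set.Ioc 0 α₀, ∫⁻ p, ENNReal.ofReal (‖g (p.1 + √α • p.2)‖ ^ 4)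
      ∂((isoGaussian θ σ).prod (isoGaussian 0 σ)) ≤ C)
    (hZ : ∀ α ∈ Set.Ioc 0 α₀, ∫⁻ p, ENNReal.ofReal (incrementQuotient g α p ^ 2)
      ∂((isoGaussian θ σ).prod (isoGaussian 0 σ)) ≤ C') :
    ∃ B : ℝ≥0∞, B < ∞ ∧ ∀ α ∈ Set.Ioc 0 α₀,
      ∫⁻ x, ENNReal.ofReal ((foldRemainder g α Y ω x - c) ^ 2) ∂P ≤ B := by
  have hy := lintegral_norm_pow_isoGaussian_lt_top θ σ 4
  set M := ∫⁻ y, ENNReal.ofReal (‖y‖ ^ 4) ∂isoGaussian θ σ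
  refine ⟨K * (ENNReal.ofReal 24 * M + (ENNReal.ofReal 24 * C + (ENNReal.ofReal 12 * C'
    + ENNReal.ofReal (3 * c ^ 2)))), ?_, fun α hα ↦ ?_⟩
  · have := ENNReal.natCast_ne_top K
    exact ENNReal.mul_lt_top (by finiteness) (by finiteness)
  let f : EuclideanSpace ℝ (Fin n) × EuclideanSpace ℝ (Fin n) → ℝ≥0∞ := fun p ↦
    ENNReal.ofReal 24 * ENNReal.ofReal (‖p.1‖ ^ 4)
      + (ENNReal.ofReal 24 * ENNReal.ofReal (‖g (p.1 + √α • p.2)‖ ^ 4)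
        + (ENNReal.ofReal 12 * ENNReal.ofReal (incrementQuotient g α p ^ 2)
          + ENNReal.ofReal (3 * c ^ 2)))
  have hf : Measurable f := by fun_prop
  have hfint : ∫⁻ p, f p ∂((isoGaussian θ σ).prod (isoGaussian 0 σ))
      ≤ ENNReal.ofReal 24 * M + (ENNReal.ofReal 24 * C + (ENNReal.ofReal 12 * C'
        + ENNReal.ofReal (3 * c ^ 2))) := by
    simp only [f]
    rw [lintegral_add_left (by fun_prop), lintegral_add_left (by fun_prop),
      lintegral_add_left (by fun_prop), lintegral_const_mul' _ _ ENNReal.ofReal_ne_top,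
      lintegral_const_mul' _ _ ENNReal.ofReal_ne_top,
      lintegral_const_mul' _ _ ENNReal.ofReal_ne_top,
      lintegral_prod_fst (f := fun y : EuclideanSpace ℝ (Fin n) ↦ ENNReal.ofReal (‖y‖ ^ 4))
        (by fun_prop)]
    simp only [lintegral_const, measure_univ, mul_one]
    gcongr
    · exact hU α hα
    · exact hZ α hα
  calc ∫⁻ x, ENNReal.ofReal ((foldRemainder g α Y ω x - c) ^ 2) ∂P
      ≤ ∫⁻ x, ∑ k, f (Y x, ω k x) ∂P := by
        refine lintegral_mono fun x ↦ (ENNReal.ofReal_le_ofReal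
          (sq_foldRemainder_sub_le hK g α Y ω x c)).trans_eq ?_
        rw [ENNReal.ofReal_sum_of_nonneg (fun _ _ ↦ by positivity)]
        refine Finset.sum_congr rfl fun k _ ↦ ?_
        simp only [f]
        rw [ENNReal.ofReal_add (by positivity) (by positivity),
          ENNReal.ofReal_add (by positivity) (by positivity),
          ENNReal.ofReal_add (by positivity) (by positivity),
          ENNReal.ofReal_mul (p := 24) (by norm_num), ENNReal.ofReal_mul (p := 24) (by norm_num),
          ENNReal.ofReal_mul (p := 12) (by norm_num)]
    _ = ∑ k, ∫⁻ x, f (Y x, ω k x) ∂P :=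
        lintegral_finsetSum' _ fun k _ ↦ hf.comp_aemeasurable (hlaw k).aemeasurable
    _ = ∑ _k : Fin K, ∫⁻ p, f p ∂((isoGaussian θ σ).prod (isoGaussian 0 σ)) :=
        Finset.sum_congr rfl fun k _ ↦ (hlaw k).lintegral_comp hf.aemeasurable
    _ ≤ _ := by
        rw [Finset.sum_const, Finset.card_univ, Fintype.card_fin, nsmul_eq_mul]
        gcongr

/-! ### The noise average under the two randomizations. -/

lemma variance_inner_isoGaussian {n : ℕ} (θ d : EuclideanSpace ℝ (Fin n)) (σ : ℝ) :
    Var[fun w ↦ inner ℝ w d; isoGaussian θ σ] = σ ^ 2 * ‖d‖ ^ 2 := by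
  simp_rw [real_inner_comm d]
  rw [← covarianceBilin_self IsGaussian.memLp_two_id, isoGaussian,
    covarianceBilin_multivariateGaussian (posSemidef_sq_smul_one σ), Matrix.smul_mulVec,
    Matrix.one_mulVec, dotProduct_smul, EuclideanSpace.real_norm_sq_eq]
  simp [dotProduct, sq]

lemma memLp_inner_isoGaussian {n : ℕ} (θ d : EuclideanSpace ℝ (Fin n)) (σ : ℝ) :
    MemLp (fun w ↦ inner ℝ w d) 2 (isoGaussian θ σ) := by
  simp_rw [real_inner_comm d]
  exact (IsGaussian.memLp_two_id (μ := isoGaussian θ σ)).const_inner d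

lemma integral_inner_isoGaussian_zero {n : ℕ} (d : EuclideanSpace ℝ (Fin n)) (σ : ℝ) :
    ∫ w, inner ℝ w d ∂isoGaussian 0 σ = 0 := by
  simp_rw [real_inner_comm d]
  have h := integral_inner (𝕜 := ℝ) (f := id) (μ := isoGaussian 0 σ) IsGaussian.integrable_id d
  simp only [id_eq] at h
  rw [h, isoGaussian, integral_id_multivariateGaussian, inner_zero_right]

/-- The `K` centred independent variables `⟨w k, d⟩` each have variance `σ²‖d‖²`, and averaging
divides it by `K`. -/
lemma lintegral_sq_inner_average {n K : ℕ} (hK : 0 < K) (d : EuclideanSpace ℝ (Fin n)) (σ : ℝ) :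
    ∫⁻ w, ENNReal.ofReal ((inner ℝ ((1 / (K : ℝ)) • ∑ k, w k) d) ^ 2)
      ∂(Measure.pi fun _ : Fin K ↦ isoGaussian (0 : EuclideanSpace ℝ (Fin n)) σ)
      = ENNReal.ofReal (σ ^ 2 / K) * ENNReal.ofReal (‖d‖ ^ 2) := by
  have hK0 : (0 : ℝ) < K := by exact_mod_cast hK
  set η := isoGaussian (0 : EuclideanSpace ℝ (Fin n)) σ
  have hL := memLp_inner_isoGaussian 0 d σ
  have hLk (k : Fin K) : MemLp (fun w : Fin K → EuclideanSpace ℝ (Fin n) ↦ (inner ℝ (w k) d : ℝ)) 2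
      (Measure.pi fun _ ↦ η) :=
    hL.comp_measurePreserving (measurePreserving_eval (fun _ ↦ η) k)
  have hS : MemLp (fun w : Fin K → EuclideanSpace ℝ (Fin n) ↦ ∑ k, (inner ℝ (w k) d : ℝ)) 2
      (Measure.pi fun _ ↦ η) := memLp_finsetSum _ fun k _ ↦ hLk k
  have hvar : Var[fun w : Fin K → EuclideanSpace ℝ (Fin n) ↦ ∑ k, (inner ℝ (w k) d : ℝ);
      Measure.pi fun _ ↦ η] = K * (σ ^ 2 * ‖d‖ ^ 2) := by
    have := variance_sum_pi (μ := fun _ : Fin K ↦ η)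
      (X := fun _ w ↦ (inner ℝ w d : ℝ)) fun _ ↦ hL
    rw [Finset.sum_fn] at this
    simp only [η, variance_inner_isoGaussian] at this
    simpa using this
  have hint : ∫ w : Fin K → EuclideanSpace ℝ (Fin n), ∑ k, (inner ℝ (w k) d : ℝ)
      ∂(Measure.pi fun _ ↦ η) = 0 := by
    rw [integral_finsetSum _ fun k _ ↦ (hLk k).integrable (by norm_num)]
    refine Finset.sum_eq_zero fun k _ ↦ ?_
    rw [integral_comp_eval (μ := fun _ : Fin K ↦ η) (i := k)
      (f := fun w ↦ (inner ℝ w d : ℝ)) (by fun_prop)]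
    exact integral_inner_isoGaussian_zero d σ
  have h := lintegral_sq_eq_variance_add hS
  rw [hvar, hint] at h
  simp_rw [inner_smul_left, sum_inner, mul_pow]
  simp only [conj_trivial]
  simp_rw [ENNReal.ofReal_mul (sq_nonneg (1 / (K : ℝ)))]
  rw [lintegral_const_mul' _ _ ENNReal.ofReal_ne_top, h, ← ENNReal.ofReal_mul (by positivity),
    ← ENNReal.ofReal_mul (by positivity)]
  congr 1
  field_simp
  ring

lemma IsIndependentRandomization.hasLaw_prod_pi {Ω : Type*} [MeasurableSpace Ω] {P : Measure Ω}
    [IsProbabilityMeasure P] {n K : ℕ} {σ : ℝ} {θ : EuclideanSpace ℝ (Fin n)}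
    {Y : Ω → EuclideanSpace ℝ (Fin n)} {ω : Fin K → Ω → EuclideanSpace ℝ (Fin n)}
    (hω : IsIndependentRandomization P σ Y ω) (hY : HasLaw Y (isoGaussian θ σ) P) :
    HasLaw (fun x ↦ (Y x, fun k ↦ ω k x))
      ((isoGaussian θ σ).prod (Measure.pi fun _ : Fin K ↦ isoGaussian 0 σ)) P :=
  hω.indep.hasLaw_prod hY (hω.iIndep.hasLaw_pi hω.law)

/-- The bounded part needs only the law of each pair `(Y, ω k)`, whatever the dependence between
folds, so one estimate serves both randomizations. -/
lemma hasLaw_prod_of_indepFun {Ω : Type*} [MeasurableSpace Ω] {P : Measure Ω}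
    [IsProbabilityMeasure P] {n K : ℕ} {σ : ℝ} {θ : EuclideanSpace ℝ (Fin n)}
    {Y : Ω → EuclideanSpace ℝ (Fin n)} {ω : Fin K → Ω → EuclideanSpace ℝ (Fin n)}
    (hlaw : ∀ k, HasLaw (ω k) (isoGaussian 0 σ) P)
    (hindep : IndepFun Y (fun x k => ω k x) P) (hY : HasLaw Y (isoGaussian θ σ) P) (k : Fin K) :
    HasLaw (fun x ↦ (Y x, ω k x)) ((isoGaussian θ σ).prod (isoGaussian 0 σ)) P :=
  IndepFun.hasLaw_prod hY (hlaw k) (hindep.comp measurable_id (measurable_pi_apply k))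

/-- Antithetic randomization variables sum to zero. -/
lemma IsAntitheticRandomization.ae_sum_eq_zero {Ω : Type*} [MeasurableSpace Ω] {P : Measure Ω}
    [IsProbabilityMeasure P] {n K : ℕ} (hK : 1 < K) {σ : ℝ}
    {Y : Ω → EuclideanSpace ℝ (Fin n)} {ω : Fin K → Ω → EuclideanSpace ℝ (Fin n)}
    (hω : IsAntitheticRandomization P σ Y ω) : ∀ᵐ x ∂P, ∑ k, ω k x = 0 := by
  have hK0 : (K : ℝ) - 1 ≠ 0 := by
    have : (1 : ℝ) < K := by exact_mod_cast hK
    linarith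
  have hmem (a : Fin n) : MemLp (fun w : EuclideanSpace ℝ (Fin n) ↦ w a) 2 (isoGaussian 0 σ) := by
    simpa [EuclideanSpace.inner_single_right] using
      memLp_inner_isoGaussian 0 (EuclideanSpace.single a (1 : ℝ)) σ
  have hL (a : Fin n) (k : Fin K) : MemLp (fun x ↦ ω k x a) 2 P := by
    have h := hmem a
    rw [← (hω.law k).map_eq] at h
    exact h.comp_of_map (hω.law k).aemeasurable
  have hmean (a : Fin n) (k : Fin K) : ∫ x, ω k x a ∂P = 0 := by
    have h := integral_inner_isoGaussian_zero (EuclideanSpace.single a (1 : ℝ)) σ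
    simp only [EuclideanSpace.inner_single_right, one_mul, conj_trivial] at h
    rw [← (hω.law k).integral_comp (by fun_prop)] at h
    simpa using h
  have hvar (a : Fin n) (k : Fin K) : cov[fun x ↦ ω k x a, fun x ↦ ω k x a; P] = σ ^ 2 := by
    have h := variance_inner_isoGaussian 0 (EuclideanSpace.single a (1 : ℝ)) σ
    simp only [EuclideanSpace.inner_single_right] at h
    rw [covariance_self (hL a k).aemeasurable]
    have h2 := variance_map (μ := P) (X := fun w : EuclideanSpace ℝ (Fin n) ↦ w a) (Y := ω k)
      (by fun_prop) (hω.law k).aemeasurable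
    rw [(hω.law k).map_eq] at h2
    simp only [one_mul, conj_trivial] at h
    rw [h] at h2
    simpa [Function.comp_def] using h2.symm
  have hcoord (a : Fin n) : ∀ᵐ x ∂P, ∑ k, ω k x a = 0 := by
    have hS : MemLp (fun x ↦ ∑ k, ω k x a) 2 P := memLp_finsetSum _ fun k _ ↦ hL a k
    have hv : Var[fun x ↦ ∑ k, ω k x a; P] = 0 := by
      rw [variance_fun_sum (hL a)]
      have hcov (i j : Fin K) : cov[fun x ↦ ω i x a, fun x ↦ ω j x a; P]
          = if i = j then σ ^ 2 else -(σ ^ 2 / ((K : ℝ) - 1)) := by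
        split_ifs with h
        · rw [h, hvar]
        · rw [hω.cov_eq i j h, if_pos rfl]
      -- The diagonal entry `σ²` is offset by `K - 1` entries `-σ²/(K - 1)`.
      have hrow (i : Fin K) : ∑ j, cov[fun x ↦ ω i x a, fun x ↦ ω j x a; P] = 0 := by
        simp_rw [hcov]
        rw [← Finset.add_sum_erase _ _ (Finset.mem_univ i), if_pos rfl,
          Finset.sum_congr rfl fun j hj ↦ if_neg (Finset.ne_of_mem_erase hj).symm]
        rw [Finset.sum_const, Finset.card_erase_of_mem (Finset.mem_univ i), Finset.card_univ,
          Fintype.card_fin, nsmul_eq_mul, Nat.cast_sub hK.le]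
        field_simp
        simp
      exact Finset.sum_eq_zero fun i _ ↦ hrow i
    filter_upwards [ae_eq_integral_of_variance_eq_zero hS hv] with x hx
    rw [hx, integral_finsetSum _ fun k _ ↦ (hL a k).integrable (by norm_num)]
    exact Finset.sum_eq_zero fun k _ ↦ hmean a k
  filter_upwards [ae_all_iff.2 hcoord] with x hx
  ext a
  simpa using hx a

/-! ### Bounds for the mean squared errors. -/

lemma aemeasurable_foldRemainder {Ω : Type*} [MeasurableSpace Ω] {P : Measure Ω} {n K : ℕ}
    {Y : Ω → EuclideanSpace ℝ (Fin n)} {ω : Fin K → Ω → EuclideanSpace ℝ (Fin n)}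
    (h : ∀ k, AEMeasurable (fun x ↦ (Y x, ω k x)) P)
    {g : EuclideanSpace ℝ (Fin n) → EuclideanSpace ℝ (Fin n)} (hg : Measurable g) (α : ℝ) :
    AEMeasurable (foldRemainder g α Y ω) P := by
  unfold foldRemainder
  refine AEMeasurable.const_mul (Finset.aemeasurable_fun_sum _ fun k _ ↦ ?_) _
  have hm : Measurable fun p : EuclideanSpace ℝ (Fin n) × EuclideanSpace ℝ (Fin n) ↦
      ‖p.1 - g (p.1 + √α • p.2)‖ ^ 2 + 2 * incrementQuotient g α p := by fun_prop
  have hcomp := hm.comp_aemeasurable (h k)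
  simpa only [Function.comp_def] using hcomp

section MeanSquaredError

variable {Ω : Type*} [MeasurableSpace Ω] {P : Measure Ω} {n K : ℕ}
  {Y : Ω → EuclideanSpace ℝ (Fin n)} {ω : Fin K → Ω → EuclideanSpace ℝ (Fin n)}
  {g : EuclideanSpace ℝ (Fin n) → EuclideanSpace ℝ (Fin n)} {α c : ℝ}

lemma mse_randomizedEstimator_le (hα : 0 < α)
    (h : ∀ k, AEMeasurable (fun x ↦ (Y x, ω k x)) P) (hg : Measurable g) :
    mse P (randomizedEstimator g α Y ω) c
      ≤ ENNReal.ofReal 2 * (∫⁻ x, ENNReal.ofReal ((foldRemainder g α Y ω x - c) ^ 2) ∂P)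
        + ENNReal.ofReal (8 / α) * ∫⁻ x, ENNReal.ofReal
          ((inner ℝ ((1 / (K : ℝ)) • ∑ k, ω k x) (Y x - g (Y x))) ^ 2) ∂P := by
  have hR := aemeasurable_foldRemainder h hg α
  rw [← lintegral_const_mul' _ _ ENNReal.ofReal_ne_top,
    ← lintegral_const_mul' _ _ ENNReal.ofReal_ne_top,
    ← lintegral_add_left' (by fun_prop), mse]
  refine lintegral_mono fun x ↦ ?_
  rw [← ENNReal.ofReal_mul (by positivity), ← ENNReal.ofReal_mul (by positivity),
    ← ENNReal.ofReal_add (by positivity) (by positivity), randomizedEstimator_eq g hα]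
  refine ENNReal.ofReal_le_ofReal ?_
  set R := foldRemainder g α Y ω x
  set D : ℝ := inner ℝ ((1 / (K : ℝ)) • ∑ k, ω k x) (Y x - g (Y x))
  have h8 : 8 / α * D ^ 2 = 2 * (2 / √α * D) ^ 2 := by
    rw [mul_pow, div_pow, Real.sq_sqrt hα.le]; ring
  rw [h8]
  nlinarith [sq_nonneg (R - c + 2 / √α * D)]

/-- The singular term is the difference of the errors of the bounded part and of the estimator, so
its square is at most twice the sum of theirs. -/
lemma lintegral_sq_inner_average_le_mse (hα : 0 < α)
    (h : ∀ k, AEMeasurable (fun x ↦ (Y x, ω k x)) P) (hg : Measurable g) :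
    ENNReal.ofReal (4 / α) * ∫⁻ x, ENNReal.ofReal
          ((inner ℝ ((1 / (K : ℝ)) • ∑ k, ω k x) (Y x - g (Y x))) ^ 2) ∂P
      ≤ ENNReal.ofReal 2 * (∫⁻ x, ENNReal.ofReal ((foldRemainder g α Y ω x - c) ^ 2) ∂P)
        + ENNReal.ofReal 2 * mse P (randomizedEstimator g α Y ω) c := by
  have hR := aemeasurable_foldRemainder h hg α
  rw [mse, ← lintegral_const_mul' _ _ ENNReal.ofReal_ne_top,
    ← lintegral_const_mul' _ _ ENNReal.ofReal_ne_top,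
    ← lintegral_const_mul' _ _ ENNReal.ofReal_ne_top,
    ← lintegral_add_left' (by fun_prop)]
  refine lintegral_mono fun x ↦ ?_
  rw [← ENNReal.ofReal_mul (by positivity), ← ENNReal.ofReal_mul (by positivity),
    ← ENNReal.ofReal_mul (by positivity),
    ← ENNReal.ofReal_add (by positivity) (by positivity), randomizedEstimator_eq g hα]
  refine ENNReal.ofReal_le_ofReal ?_
  set R := foldRemainder g α Y ω x
  set D : ℝ := inner ℝ ((1 / (K : ℝ)) • ∑ k, ω k x) (Y x - g (Y x))
  have h4 : 4 / α * D ^ 2 = (2 / √α * D) ^ 2 := by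
    rw [mul_pow, div_pow, Real.sq_sqrt hα.le]; ring
  rw [h4]
  nlinarith [sq_nonneg (R - c + (R - 2 / √α * D - c))]

/-- Conditionally on `Y`, `lintegral_sq_inner_average` applies with `d = Y - g(Y)`. -/
lemma lintegral_sq_inner_average_eq [IsProbabilityMeasure P] (hK : 0 < K) {σ : ℝ}
    {θ : EuclideanSpace ℝ (Fin n)} (hω : IsIndependentRandomization P σ Y ω)
    (hY : HasLaw Y (isoGaussian θ σ) P) (hg : Measurable g) :
    ∫⁻ x, ENNReal.ofReal ((inner ℝ ((1 / (K : ℝ)) • ∑ k, ω k x) (Y x - g (Y x))) ^ 2) ∂P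
      = ENNReal.ofReal (σ ^ 2 / K) * ∫⁻ x, ENNReal.ofReal (‖Y x - g (Y x)‖ ^ 2) ∂P := by
  let f : EuclideanSpace ℝ (Fin n) × (Fin K → EuclideanSpace ℝ (Fin n)) → ℝ≥0∞ := fun p ↦
    ENNReal.ofReal ((inner ℝ ((1 / (K : ℝ)) • ∑ k, p.2 k) (p.1 - g p.1)) ^ 2)
  let f' : EuclideanSpace ℝ (Fin n) → ℝ≥0∞ := fun y ↦ ENNReal.ofReal (‖y - g y‖ ^ 2)
  have hf : Measurable f := by fun_prop
  have hf' : Measurable f' := by fun_prop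
  calc _ = ∫⁻ x, f (Y x, fun k ↦ ω k x) ∂P := rfl
    _ = ∫⁻ y, ∫⁻ w, f (y, w) ∂(Measure.pi fun _ : Fin K ↦ isoGaussian 0 σ) ∂isoGaussian θ σ := by
        rw [(hω.hasLaw_prod_pi hY).lintegral_comp hf.aemeasurable,
          lintegral_prod _ hf.aemeasurable]
    _ = ∫⁻ y, ENNReal.ofReal (σ ^ 2 / K) * f' y ∂isoGaussian θ σ := by
        refine lintegral_congr fun y ↦ ?_
        exact lintegral_sq_inner_average hK (y - g y) σ
    _ = ENNReal.ofReal (σ ^ 2 / K) * ∫⁻ x, f' (Y x) ∂P := by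
        rw [lintegral_const_mul' _ _ ENNReal.ofReal_ne_top, hY.lintegral_comp hf'.aemeasurable]

end MeanSquaredError

/-- The zero sum of the noise removes the singular term exactly, for each `α > 0`. -/
lemma mse_randomizedEstimator_antithetic {Ω : Type*} [MeasurableSpace Ω] {P : Measure Ω}
    [IsProbabilityMeasure P] {n K : ℕ} (hK : 1 < K) {σ : ℝ}
    {Y : Ω → EuclideanSpace ℝ (Fin n)} {ω : Fin K → Ω → EuclideanSpace ℝ (Fin n)}
    (hω : IsAntitheticRandomization P σ Y ω)
    (g : EuclideanSpace ℝ (Fin n) → EuclideanSpace ℝ (Fin n)) {α : ℝ} (hα : 0 < α) (c : ℝ) :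
    mse P (randomizedEstimator g α Y ω) c
      = ∫⁻ x, ENNReal.ofReal ((foldRemainder g α Y ω x - c) ^ 2) ∂P := by
  refine lintegral_congr_ae ?_
  filter_upwards [hω.ae_sum_eq_zero hK] with x hx
  rw [randomizedEstimator_eq g hα, hx]
  simp

/-! ### Asymptotics as `α ↓ 0`. -/

/-- A function squeezed between two multiples of `1 / α`, up to bounded terms, is of exact order
`1 / α` at zero, and any bounded function minus it tends to `-∞`. -/
lemma isTheta_one_div_and_tendsto_sub {m v : ℝ → ℝ} {α₀ B C D : ℝ} (hα₀ : 0 < α₀) (hC : 0 ≤ C)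
    (hD : 0 < D) (hm0 : ∀ α, 0 ≤ m α) (hup : ∀ α ∈ Set.Ioc 0 α₀, m α ≤ 2 * C + 8 / α * D)
    (hlow : ∀ α ∈ Set.Ioc 0 α₀, 4 / α * D ≤ 2 * C + 2 * m α)
    (hv : ∀ α ∈ Set.Ioc 0 α₀, v α ≤ B) :
    (m =Θ[𝓝[>] (0 : ℝ)] fun α ↦ 1 / α) ∧
      Tendsto (fun α ↦ v α - m α) (𝓝[>] (0 : ℝ)) atBot := by
  have hmem : ∀ᶠ α in 𝓝[>] (0 : ℝ), α ∈ Set.Ioc 0 α₀ := Ioc_mem_nhdsGT hα₀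
  -- For such `α` one has `C ≤ D/α`, so `hlow` gives `m α ≥ 2D/α - C ≥ D/α`. The `+ 1` covers `C =
  -- 0`.
  have hsmall : ∀ᶠ α in 𝓝[>] (0 : ℝ), α ∈ Set.Ioc 0 (D / (C + 1)) :=
    Ioc_mem_nhdsGT (by positivity)
  have hge : ∀ᶠ α in 𝓝[>] (0 : ℝ), 0 < α ∧ D * (1 / α) ≤ m α := by
    filter_upwards [hmem, hsmall] with α h1 h2
    have hα := h1.1
    have h3 : C ≤ D * (1 / α) := by
      rw [mul_one_div, le_div_iff₀ hα]
      have := (le_div_iff₀ (by positivity)).1 h2.2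
      nlinarith
    have h4 := hlow α h1
    have h5 : 4 / α * D = 4 * (D * (1 / α)) := by ring
    exact ⟨hα, by linarith⟩
  refine ⟨⟨?_, ?_⟩, ?_⟩
  -- On `(0, α₀]` the constant `2C` is at most `2Cα₀/α`.
  · refine IsBigO.of_bound (2 * C * α₀ + 8 * D) ?_
    filter_upwards [hmem] with α h1
    have hα := h1.1
    rw [Real.norm_of_nonneg (hm0 α), Real.norm_of_nonneg (by positivity)]
    refine (hup α h1).trans ?_
    have h3 : 1 ≤ α₀ * (1 / α) := by
      rw [mul_one_div, le_div_iff₀ hα]; linarith [h1.2]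
    have h5 : 8 / α * D = 8 * D * (1 / α) := by ring
    nlinarith
  · refine IsBigO.of_bound (1 / D) ?_
    filter_upwards [hge] with α ⟨hα, h1⟩
    rw [Real.norm_of_nonneg (hm0 α), Real.norm_of_nonneg (by positivity), one_div_mul_eq_div,
      le_div_iff₀ hD]
    linarith
  · have hinv : Tendsto (fun α : ℝ ↦ B - D * (1 / α)) (𝓝[>] (0 : ℝ)) atBot := by
      have h := (tendsto_inv_nhdsGT_zero (𝕜 := ℝ)).const_mul_atTop hD
      simp_rw [one_div, sub_eq_add_neg]
      exact tendsto_atBot_add_const_left _ _ (tendsto_neg_atTop_atBot.comp h)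
    refine tendsto_atBot_mono' _ ?_ hinv
    filter_upwards [hge, hmem] with α ⟨_, h1⟩ h2
    linarith [hv α h2]

theorem mainTheorem4 {Ω : Type*} [MeasurableSpace Ω] (P : Measure Ω) [IsProbabilityMeasure P]
    (n K : ℕ) (hK : 1 < K) (σ : ℝ) (hσ : 0 < σ) (θ : EuclideanSpace ℝ (Fin n))
    (Y : Ω → EuclideanSpace ℝ (Fin n)) (hY : HasLaw Y (isoGaussian θ σ) P)
    (ω ω' : Fin K → Ω → EuclideanSpace ℝ (Fin n))
    (hω : IsAntitheticRandomization P σ Y ω)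
    (hω' : IsIndependentRandomization P σ Y ω')
    (g : EuclideanSpace ℝ (Fin n) → EuclideanSpace ℝ (Fin n)) (hg : Measurable g)
    (Dg : Fin n → EuclideanSpace ℝ (Fin n) → EuclideanSpace ℝ (Fin n))
    (hDg : ∀ i, IsWeakGradient (fun y => g y i) (Dg i))
    (hg4 : Integrable (fun x => ‖g (Y x)‖ ^ 4) P)
    (hDg2 : Integrable (fun x => frobeniusSq (jacobian Dg (Y x))) P)
    -- the mean squared error of the coupled bootstrap is finite for some value of the parameter
    (hfin : ∃ α₀ : ℝ, 0 < α₀ ∧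
      mse P (randomizedEstimator g α₀ Y ω') (predictionError (isoGaussian θ σ) g) < ∞)
    -- the prediction function is not almost surely the identity
    (hid : ¬ ∀ᵐ x ∂P, g (Y x) = Y x) :
    -- `MSE(CV_α)` stays bounded
    (∃ C : ℝ≥0, ∀ᶠ α in 𝓝[>] (0 : ℝ),
      mse P (randomizedEstimator g α Y ω) (predictionError (isoGaussian θ σ) g) ≤ C) ∧
    -- `MSE(CB_α)` is finite and of exact order `1 / α`
    (∀ᶠ α in 𝓝[>] (0 : ℝ),
      mse P (randomizedEstimator g α Y ω') (predictionError (isoGaussian θ σ) g) < ∞) ∧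
    ((fun α : ℝ =>
        (mse P (randomizedEstimator g α Y ω') (predictionError (isoGaussian θ σ) g)).toReal)
      =Θ[𝓝[>] (0 : ℝ)] fun α : ℝ => 1 / α) ∧
    -- `MSE(CV_α) - MSE(CB_α) → -∞`
    Tendsto (fun α : ℝ =>
        (mse P (randomizedEstimator g α Y ω) (predictionError (isoGaussian θ σ) g)).toReal -
        (mse P (randomizedEstimator g α Y ω') (predictionError (isoGaussian θ σ) g)).toReal)
      (𝓝[>] (0 : ℝ)) atBot := by
  obtain ⟨α₀, hα₀, hfin⟩ := hfin
  set c := predictionError (isoGaussian θ σ) g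
  have hK' : 0 < K := by omega
  have hK0 : (0 : ℝ) < K := by exact_mod_cast hK'
  -- moment bounds at the perturbed data
  have hfin' : ∫⁻ p, ENNReal.ofReal (((1 / (K : ℝ)) * ∑ k, foldEstimate g α₀ p.1 (p.2 k) - c) ^ 2)
      ∂((isoGaussian θ σ).prod
        (Measure.pi fun _ : Fin K ↦ isoGaussian (0 : EuclideanSpace ℝ (Fin n)) σ)) < ∞ := by
    have hmk (k : Fin K) := measurable_uncurry_eval (measurable_foldEstimate hg α₀) k
    let f : EuclideanSpace ℝ (Fin n) × (Fin K → EuclideanSpace ℝ (Fin n)) → ℝ≥0∞ := fun p ↦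
      ENNReal.ofReal (((1 / (K : ℝ)) * ∑ k, foldEstimate g α₀ p.1 (p.2 k) - c) ^ 2)
    have hf : Measurable f := by fun_prop
    exact ((hω'.hasLaw_prod_pi hY).lintegral_comp hf.aemeasurable).symm.trans_lt hfin
  obtain ⟨C, hC, hU⟩ := exists_lintegral_norm_pow_four_le hσ θ hg hα₀
    (lintegral_norm_pow_four_lt_top_of_foldEstimate hK' θ hg hα₀ c hfin')
  have hgL : ∫⁻ y, ENNReal.ofReal (‖g y‖ ^ 4) ∂isoGaussian θ σ < ∞ := by
    rw [← hY.lintegral_comp (by fun_prop)]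
    exact hg4.lintegral_lt_top
  have hDgL : ∫⁻ y, ENNReal.ofReal (frobeniusSq (jacobian Dg y)) ∂isoGaussian θ σ < ∞ := by
    rw [← hY.lintegral_comp]
    · exact hDg2.lintegral_lt_top
    · exact (aemeasurable_ofReal_frobeniusSq_jacobian hDg).mono_ac
        (isoGaussian_absolutelyContinuous θ hσ)
  obtain ⟨C', hC', hZ⟩ := exists_lintegral_sq_incrementQuotient_le hσ θ hg hDg hDgL hC hU hgL
  -- the bounded parts of both estimators
  have hl := hasLaw_prod_of_indepFun hω.law hω.indep hY
  have hl' := hasLaw_prod_of_indepFun hω'.law hω'.indep hY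
  obtain ⟨B, hB, hR⟩ := exists_lintegral_sq_foldRemainder_le hK' hl hg c hC hC' hU hZ
  obtain ⟨B', hB', hR'⟩ := exists_lintegral_sq_foldRemainder_le hK' hl' hg c hC hC' hU hZ
  -- the unbounded part of the coupled bootstrap estimator
  set V := ∫⁻ x, ENNReal.ofReal
    ((inner ℝ ((1 / (K : ℝ)) • ∑ k, ω' k x) (Y x - g (Y x))) ^ 2) ∂P with hVdef
  have hVeq : V = ENNReal.ofReal (σ ^ 2 / K) * ∫⁻ x, ENNReal.ofReal (‖Y x - g (Y x)‖ ^ 2) ∂P :=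
    lintegral_sq_inner_average_eq hK' hω' hY hg
  have hYm := hY.aemeasurable
  have hgY : AEMeasurable (fun x ↦ g (Y x)) P := hg.comp_aemeasurable hYm
  have hVtop : V < ∞ := by
    rw [hVeq]
    refine ENNReal.mul_lt_top ENNReal.ofReal_lt_top ?_
    -- Second moments reduce to fourth ones through `t² ≤ t⁴ + 1`.
    have hle : ∫⁻ x, ENNReal.ofReal (‖Y x - g (Y x)‖ ^ 2) ∂P ≤ ∫⁻ x, (ENNReal.ofReal 8 *
        ENNReal.ofReal (‖Y x‖ ^ 4) + ENNReal.ofReal 8 * ENNReal.ofReal (‖g (Y x)‖ ^ 4)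
        + ENNReal.ofReal 1) ∂P := by
      refine lintegral_mono fun x ↦ ?_
      rw [← ENNReal.ofReal_mul (by positivity), ← ENNReal.ofReal_mul (by positivity),
        ← ENNReal.ofReal_add (by positivity) (by positivity),
        ← ENNReal.ofReal_add (by positivity) (by positivity)]
      refine ENNReal.ofReal_le_ofReal ?_
      have h4 := pow_four_norm_sub_le (Y x) (g (Y x))
      nlinarith [sq_nonneg (‖Y x - g (Y x)‖ ^ 2 - 1)]
    refine hle.trans_lt ?_
    rw [lintegral_add_right _ (by fun_prop), lintegral_add_left' (by fun_prop),
      lintegral_const_mul' _ _ ENNReal.ofReal_ne_top,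
      lintegral_const_mul' _ _ ENNReal.ofReal_ne_top,
      hY.lintegral_comp (f := fun y ↦ ENNReal.ofReal (‖y‖ ^ 4)) (by fun_prop)]
    have h1 := lintegral_norm_pow_isoGaussian_lt_top θ σ 4
    have h2 := hg4.lintegral_lt_top
    simp only [lintegral_const, measure_univ, mul_one]
    finiteness
  have hVpos : V ≠ 0 := by
    rw [hVeq]
    -- As `σ²/K > 0`, vanishing of `V` would force `g(Y) = Y` almost surely.
    refine mul_ne_zero (by simpa using by positivity) fun h0 ↦ hid ?_
    rw [lintegral_eq_zero_iff' (by fun_prop)] at h0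
    filter_upwards [h0] with x hx
    have : ‖Y x - g (Y x)‖ ^ 2 ≤ 0 := by simpa using hx
    have h2 : ‖Y x - g (Y x)‖ = 0 := by nlinarith [norm_nonneg (Y x - g (Y x))]
    exact (sub_eq_zero.1 (norm_eq_zero.1 h2)).symm
  -- bounds for the mean squared errors
  have hcv : ∀ α ∈ Set.Ioc 0 α₀, mse P (randomizedEstimator g α Y ω) c ≤ B := fun α hα ↦ by
    rw [mse_randomizedEstimator_antithetic hK hω g hα.1]
    exact hR α hα
  have hcb : ∀ α ∈ Set.Ioc 0 α₀, mse P (randomizedEstimator g α Y ω') c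
      ≤ ENNReal.ofReal 2 * B' + ENNReal.ofReal (8 / α) * V := fun α hα ↦ by
    refine (mse_randomizedEstimator_le hα.1 (fun k ↦ (hl' k).aemeasurable) hg).trans ?_
    gcongr
    exact hR' α hα
  have hcb' : ∀ α ∈ Set.Ioc 0 α₀, ENNReal.ofReal (4 / α) * V
      ≤ ENNReal.ofReal 2 * B' + ENNReal.ofReal 2 * mse P (randomizedEstimator g α Y ω') c :=
    fun α hα ↦ by
    refine (lintegral_sq_inner_average_le_mse hα.1 (fun k ↦ (hl' k).aemeasurable) hg
      (c := c)).trans ?_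
    gcongr
    exact hR' α hα
  have hcbfin : ∀ α ∈ Set.Ioc 0 α₀, mse P (randomizedEstimator g α Y ω') c < ∞ := fun α hα ↦
    (hcb α hα).trans_lt (by finiteness)
  have hmem : ∀ᶠ α in 𝓝[>] (0 : ℝ), α ∈ Set.Ioc 0 α₀ := Ioc_mem_nhdsGT hα₀
  refine ⟨⟨B.toNNReal, ?_⟩, ?_, ?_⟩
  · filter_upwards [hmem] with α hα
    rw [ENNReal.coe_toNNReal hB.ne]
    exact hcv α hα
  · filter_upwards [hmem] with α hα using hcbfin α hα
  · refine isTheta_one_div_and_tendsto_sub (B := B.toReal) (C := B'.toReal) (D := V.toReal) hα₀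
      ENNReal.toReal_nonneg (ENNReal.toReal_pos hVpos hVtop.ne) (fun _ ↦ ENNReal.toReal_nonneg)
      (fun α hα ↦ ?_) (fun α hα ↦ ?_) (fun α hα ↦ ENNReal.toReal_mono hB.ne (hcv α hα))
    · have h := ENNReal.toReal_mono (by finiteness) (hcb α hα)
      have hα0 := hα.1
      rwa [ENNReal.toReal_add (by finiteness) (by finiteness), ENNReal.toReal_mul,
        ENNReal.toReal_mul, ENNReal.toReal_ofReal (by positivity),
        ENNReal.toReal_ofReal (by positivity)] at h
    · have hf := hcbfin α hα
      have h := ENNReal.toReal_mono (by finiteness) (hcb' α hα)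
      have hα0 := hα.1
      rwa [ENNReal.toReal_add (by finiteness) (by finiteness), ENNReal.toReal_mul,
        ENNReal.toReal_mul, ENNReal.toReal_mul, ENNReal.toReal_ofReal (by positivity),
        ENNReal.toReal_ofReal (by positivity)] at h
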